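/- A length function on a group $G$ is a function $l:G\to[0,\infty)$ such that $l(g^m)=|m|\,l(g)$ for all $g\in G$, $m\in\mathbb{Z}$; $l(aga^{-1})=l(g)$ for all $a,g\in G$; and $l(ab)\le l(a)+l(b)$ whenever $a,b\in G$ commute. It is purely positive if $l(g)>0$ for every element $g$ of infinite order. A group $G$ is virtually poly-positive if it has a finite-index subgroup $H$ and a subnormal series $1=H_k\trianglelefteq H_{k-1}\trianglelefteq\cdots\trianglelefteq H_0=H$ such that every finitely generated subgroup of each quotient $H_i/H_{i+1}$ $(0\le i<k)$ has a purely positive length function. For an associative ring $R$ with identity, $E_n(R)$ denotes the subgroup of $\mathrm{GL}_n(R)$ generated by the elementary matrices $e_{ij}(r)$ ($1\le i\ne j\le n$, $r\in R$), where $e_{ij}(r)$ has $1$'s on the diagonal, $r$ in position $(i,j)$ and $0$ elsewhere. **Theorem.** Let $G$ be a virtually poly-positive group. Let $R$ be a finitely generated associative (not necessarily commutative) ring with identity, of characteristic zero, such that every nonzero two-sided ideal of $R$ has finite index in $R$. Let $n\ge 3$ and let $S$ be a finite-index subgroup of $E_n(R)$. Then every group homomorphism $f:S\to G$ has finite image.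 -/

import Mathlib

open Matrix

universe u v

/-- A length function `l : G → [0, ∞)` on a group: homogeneous on cyclic subgroups, conjugation
invariant, and subadditive on commuting pairs. -/
structure IsLengthFunction {G : Type u} [Group G] (l : G → ℝ) : Prop where
  nonneg : ∀ g : G, 0 ≤ l g
  map_zpow : ∀ (g : G) (n : ℤ), l (g ^ n) = |(n : ℝ)| * l g
  map_conj : ∀ a g : G, l (a * g * a⁻¹) = l g
  map_mul_le : ∀ a b : G, Commute a b → l (a * b) ≤ l a + l b

/-- The group has a purely positive length function: one which is positive on every element of
infinite order. -/
def HasPurelyPositiveLength (G : Type u) [Group G] : Prop :=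
  ∃ l : G → ℝ, IsLengthFunction l ∧ ∀ g : G, ¬ IsOfFinOrder g → 0 < l g

/-- A group is poly-positive if it has a subnormal series `1 = H n ⊴ ⋯ ⊴ H 0 = G` such that every
finitely generated subgroup of each quotient `H i / H (i + 1)` has a purely positive length
function. (Only the values `H 0, …, H n` of the sequence matter.) -/
def IsPolyPositive (G : Type u) [Group G] : Prop :=
  ∃ (n : ℕ) (H : ℕ → Subgroup G), H 0 = ⊤ ∧ H n = ⊥ ∧
    ∀ i < n, H (i + 1) ≤ H i ∧
      ∃ _ : ((H (i + 1)).subgroupOf (H i)).Normal,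
        ∀ K : Subgroup (H i ⧸ (H (i + 1)).subgroupOf (H i)),
          K.FG → HasPurelyPositiveLength K

/-- A group is virtually poly-positive if it has a poly-positive subgroup of finite index. -/
def IsVirtuallyPolyPositive (G : Type u) [Group G] : Prop :=
  ∃ H : Subgroup G, H.FiniteIndex ∧ IsPolyPositive H

/-- The elementary matrix `e i j r`, with `1`s on the diagonal, `r` in position `(i, j)` and zeros
elsewhere, as an invertible matrix over a (not necessarily commutative) ring. -/
def elementaryUnit {n : ℕ} {R : Type v} [Ring R] (i j : Fin n) (hij : i ≠ j) (r : R) :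
    GL (Fin n) R where
  val := 1 + Matrix.single i j r
  inv := 1 - Matrix.single i j r
  val_inv := by
    have h : Matrix.single i j r * Matrix.single i j r = 0 :=
      by simp [hij.symm]
    rw [add_mul, mul_sub, mul_sub, h]; simp
  inv_val := by
    have h : Matrix.single i j r * Matrix.single i j r = 0 :=
      by simp [hij.symm]
    rw [sub_mul, mul_add, mul_add, h]; simp

/-- The elementary group `E_n(R)`: the subgroup of `GL_n(R)` generated by all elementary
matrices. -/
def elementaryGroup (n : ℕ) (R : Type v) [Ring R] : Subgroup (GL (Fin n) R) :=
  Subgroup.closure {g | ∃ (i j : Fin n) (hij : i ≠ j) (r : R), g = elementaryUnit i j hij r}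

/-!
# Homomorphisms from elementary groups to virtually poly-positive groups

Put `E = E_n(R)` with `n ≥ 3`, and write `x i j r` for the elementary matrices.

*Length functions.* If `z = [x, y]` commutes with `x` and `y`, then `z ^ k * y` is conjugate to `y`,
so a length function satisfies `k * l z ≤ 2 * l y` for all `k`, whence `l z = 0`
(`IsLengthFunction.eq_zero_of_mul_eq`). For a purely positive `l` this makes `z` an element of
finite order. As `x i j (M * M)` is the commutator of `x i l M` and `x l j M`, one descends along
the subnormal series of the target: if all `x i j M` map into one term, then some powers of the
`x i j (M * M)` map into the next. Hence the kernel of `f` contains all `x i j M` for some integer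
`M > 0` (`IsSteinberg.exists_map_eq_one_of_isPolyPositive`), and, after commutators with elements
of `S` and passage to the normal core `N` of the kernel in `E`, all `x i j r` with `r` in a nonzero
ideal `M R` (`IsSteinberg.exists_mem_normalCore`).

*Finiteness of `E ⧸ N`.* The ideal `M R` has finite index, so `E ⧸ N` is generated by elements that
satisfy the Steinberg relations over the finite ring `A = R ⧸ M R`. Every such group `Q` is finite
(`IsSteinberg.finite`). Single out one index, giving rise to an abelian column group and an abelian
row group, both finite. The cosets of the normalizer `P` of the row group behave like last columns
of matrices: because finite rings have stable range one (`exists_isUnit_add_mul`), each coset has a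
representative in a product of two columns and a row (`IsSteinberg.exists_mk_eq`), so `P`
has finite index, and so has the centralizer of each row. As the index was arbitrary, the
centralizers of all generators, and with them the center of `Q`, have finite index. By Schur's
theorem the commutator subgroup of `Q` is finite, and `Q` is perfect.

What makes the cosets behave well is the rank one identity `IsSteinberg.exists_mul_eq_weyl_mul`: it
moves a column element across a row element when a unit `1 + γ d` is available. It rests on
comparing the lifts to `Q` of diagonal matrices for two pairs of indices
(`IsSteinberg.diagLift_eq`).
-/

/-! ### Stable range one for finite rings -/

section StableRange

variable {A : Type*} [Ring A]

/-- If an idempotent `e` kills `c` from the left and `A c + A b = A`, then the left ideal `A c` can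
be enlarged by adding a multiple of `b` to `c`. Indeed `e A c ≠ e A` by counting, so some `e s b`
lies outside `A c`; adding it to `c` does not affect `(1 - e) c = c`. -/
theorem exists_span_lt_of_isIdempotentElem [Finite A] {b c e : A} (he : IsIdempotentElem e)
    (he0 : e ≠ 0) (hec : e * c = 0) (hbc : ∃ x y, x * c + y * b = 1) :
    ∃ t, Ideal.span {c} < Ideal.span {c + t * b} := by
  obtain ⟨x, y, hxy⟩ := hbc
  by_cases h : ∃ s, e * s * b ∉ Ideal.span {c}
  · obtain ⟨s, hs⟩ := h
    refine ⟨e * s, lt_of_le_of_ne ?_ ?_⟩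
    · rw [Ideal.span_singleton_le_iff_mem, Ideal.mem_span_singleton']
      refine ⟨1 - e, ?_⟩
      have h2 : e * (e * s * b) = e * s * b := by rw [mul_assoc, ← mul_assoc e e, he.eq]
      rw [sub_mul, one_mul, mul_add, hec, h2]
      abel
    · intro heq
      apply hs
      rw [heq, Ideal.mem_span_singleton']
      exact ⟨e, by rw [mul_add, hec, zero_add, ← mul_assoc, ← mul_assoc, he.eq]⟩
  · -- otherwise right multiplication by `c` maps `eA` onto itself, yet it kills `e ∈ eA`
    exfalso
    push Not at h
    let X := {z : A // e * z = z}
    let F : X → X := fun z => ⟨z.1 * c, by rw [← mul_assoc, z.2]⟩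
    have hsurj : Function.Surjective F := by
      rintro ⟨z, hz⟩
      have hmem : z ∈ Ideal.span {c} := by
        have : z = (z * x) * c + e * (z * y) * b := by
          rw [← mul_assoc e z, hz, mul_assoc, mul_assoc, ← mul_add, hxy, mul_one]
        rw [this]
        exact add_mem (Ideal.mem_span_singleton'.2 ⟨_, rfl⟩) (h _)
      obtain ⟨w, hw⟩ := Ideal.mem_span_singleton'.1 hmem
      refine ⟨⟨e * w, by rw [← mul_assoc, he.eq]⟩, Subtype.ext ?_⟩
      change e * w * c = z
      rw [mul_assoc, hw, hz]
    have hinj := Finite.injective_iff_surjective.2 hsurj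
    have : (⟨e, he⟩ : X) = ⟨0, mul_zero e⟩ := hinj (Subtype.ext (by simp [F, hec]))
    exact he0 (congrArg Subtype.val this)

theorem exists_isUnit_add_mul_of_isSemisimpleRing [Finite A] [IsSemisimpleRing A] {a b : A}
    (hab : ∃ x y, x * a + y * b = 1) : ∃ t, IsUnit (a + t * b) := by
  obtain ⟨t, -, ht⟩ := (Set.finite_univ (α := A)).exists_maximalFor
    (fun t => Ideal.span {a + t * b}) Set.univ ⟨0, trivial⟩
  refine ⟨t, ?_⟩
  set c := a + t * b with hc
  have hbc : ∃ x y, x * c + y * b = 1 := by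
    obtain ⟨x, y, h⟩ := hab
    refine ⟨x, y - x * t, ?_⟩
    rw [← h, hc, sub_mul, mul_add, mul_assoc]
    abel
  have hmax : ¬ ∃ s, Ideal.span {c} < Ideal.span {c + s * b} := by
    rintro ⟨s, hs⟩
    have h1 : c + s * b = a + (t + s) * b := by rw [hc, add_mul]; abel
    rw [h1] at hs
    exact absurd (ht (Set.mem_univ (t + s)) hs.le) (not_le_of_gt hs)
  -- the left annihilator of `c` is generated by an idempotent, which has to vanish
  obtain ⟨e, he, hK⟩ := IsSemisimpleRing.ideal_eq_span_idempotent
    (LinearMap.ker (LinearMap.toSpanSingleton A A c))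
  have hec : e * c = 0 := by
    have : e ∈ LinearMap.ker (LinearMap.toSpanSingleton A A c) := by
      rw [hK]; exact Ideal.mem_span_singleton_self e
    simpa using this
  have he0 : e = 0 := by
    by_contra h0
    exact hmax (exists_span_lt_of_isIdempotentElem he h0 hec hbc)
  have hinj : Function.Injective (LinearMap.toSpanSingleton A A c) := by
    rw [← LinearMap.ker_eq_bot, hK, he0, Ideal.span_singleton_zero]
  obtain ⟨x, hx⟩ := (Finite.injective_iff_surjective.1 hinj) 1
  exact IsUnit.of_mul_eq_one_right x (by simpa using hx)

/-- Finite rings have stable range one: this holds modulo the nilpotent Jacobson radical, where a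
multiple `t` for which the left ideal `A (a + t b)` is maximal does the job. -/
theorem exists_isUnit_add_mul [Finite A] {a b x y : A} (hab : x * a + y * b = 1) :
    ∃ t, IsUnit (a + t * b) := by
  let π := Ideal.Quotient.mk (Ring.jacobson A)
  have hfin : Finite (A ⧸ Ring.jacobson A) := Finite.of_surjective π Ideal.Quotient.mk_surjective
  obtain ⟨s, hs⟩ := exists_isUnit_add_mul_of_isSemisimpleRing (a := π a) (b := π b)
    ⟨π x, π y, by rw [← map_mul, ← map_mul, ← map_add, hab, map_one]⟩
  obtain ⟨t, rfl⟩ := Ideal.Quotient.mk_surjective s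
  refine ⟨t, ?_⟩
  obtain ⟨z, hz⟩ := hs.exists_left_inv
  obtain ⟨w, rfl⟩ := Ideal.Quotient.mk_surjective z
  have hmem : w * (a + t * b) - 1 ∈ Ring.jacobson A := by
    rw [← Ideal.Quotient.eq_zero_iff_mem, map_sub, map_mul, map_add, map_mul, map_one]
    exact sub_eq_zero.2 hz
  have hnil : IsNilpotent (w * (a + t * b) - 1) := by
    obtain ⟨n, hn⟩ := IsSemiprimaryRing.isNilpotent (R := A)
    exact ⟨n, by simpa [hn] using Ideal.pow_mem_pow hmem n⟩
  have hu : IsUnit (w * (a + t * b)) := by simpa using hnil.isUnit_one_add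
  obtain ⟨v, hv⟩ := hu.exists_left_inv
  exact IsUnit.of_mul_eq_one_right (v * w) (by rw [mul_assoc]; exact hv)

end StableRange

/-! ### Steinberg relations -/

/-- The elements `x i j a` (`i ≠ j`) of a group satisfy the Steinberg relations over the ring `A`.
The last one says that the commutator of `x i j a` and `x j k b` is `x i k (a * b)`. The values
`x i i a` are irrelevant. -/
structure IsSteinberg {ι A Q : Type*} [Ring A] [Group Q] (x : ι → ι → A → Q) : Prop where
  map_add : ∀ {i j : ι}, i ≠ j → ∀ a b : A, x i j (a + b) = x i j a * x i j b
  commute : ∀ {i j k l : ι}, i ≠ j → k ≠ l → j ≠ k → i ≠ l →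
    ∀ a b : A, Commute (x i j a) (x k l b)
  mul_comm' : ∀ {i j k : ι}, i ≠ j → j ≠ k → i ≠ k →
    ∀ a b : A, x i j a * x j k b = x i k (a * b) * (x j k b * x i j a)

namespace IsSteinberg

variable {ι A Q : Type*} [Ring A] [Group Q] {x : ι → ι → A → Q}

theorem map_zero (hx : IsSteinberg x) {i j : ι} (hij : i ≠ j) : x i j 0 = 1 := by
  have := hx.map_add hij 0 0
  rwa [add_zero, left_eq_mul] at this

theorem map_neg (hx : IsSteinberg x) {i j : ι} (hij : i ≠ j) (a : A) :
    x i j (-a) = (x i j a)⁻¹ := by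
  rw [eq_inv_iff_mul_eq_one, ← hx.map_add hij, neg_add_cancel, hx.map_zero hij]

theorem comp_injective (hx : IsSteinberg x) {ι' : Type*} {σ : ι' → ι}
    (hσ : Function.Injective σ) : IsSteinberg fun i j a => x (σ i) (σ j) a where
  map_add hij := hx.map_add (hσ.ne hij)
  commute hij hkl hjk hil := hx.commute (hσ.ne hij) (hσ.ne hkl) (hσ.ne hjk) (hσ.ne hil)
  mul_comm' hij hjk hik := hx.mul_comm' (hσ.ne hij) (hσ.ne hjk) (hσ.ne hik)

/-- `x j k a` acts on the column with entries `p`, `q` in the places `j`, `k`. -/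
theorem semiconjBy_col (hx : IsSteinberg x) {i j k : ι} (hij : i ≠ j) (hjk : j ≠ k) (hik : i ≠ k)
    (a p q : A) :
    SemiconjBy (x j k a) (x j i p * x k i q) (x j i (p + a * q) * x k i q) := by
  have h1 : Commute (x j k a) (x j i p) := hx.commute hjk hij.symm hjk.symm hij.symm a p
  rw [SemiconjBy, ← mul_assoc, h1.eq, mul_assoc, hx.mul_comm' hjk hik.symm hij.symm,
    hx.map_add hij.symm]
  group

theorem semiconjBy_col' (hx : IsSteinberg x) {i j k : ι} (hij : i ≠ j) (hjk : j ≠ k) (hik : i ≠ k)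
    (a p q : A) :
    SemiconjBy (x k j a) (x j i p * x k i q) (x j i p * x k i (q + a * p)) := by
  have h1 : ∀ p q : A, Commute (x j i p) (x k i q) :=
    fun p q => hx.commute hij.symm hik.symm hik hij.symm p q
  rw [(h1 _ _).eq, (h1 _ _).eq]
  exact hx.semiconjBy_col hik hjk.symm hij a q p

/-- `x j k a` acts on the row with entries `p`, `q` in the places `j`, `k`. -/
theorem semiconjBy_row (hx : IsSteinberg x) {i j k : ι} (hij : i ≠ j) (hjk : j ≠ k) (hik : i ≠ k)
    (a p q : A) :
    SemiconjBy (x j k a) (x i j p * x i k q) (x i j p * x i k (q - p * a)) := by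
  have h1 : Commute (x j k a) (x i k q) := hx.commute hjk hik hik.symm hjk a q
  have h2 : ∀ b c : A, Commute (x i k b) (x i k c) := fun b c => hx.commute hik hik hik.symm hik b c
  have h4 : ∀ b : A, Commute (x i j p) (x i k b) := fun b => hx.commute hij hik hij.symm hik p b
  have h3 := hx.mul_comm' hij hjk hik p a
  have h5 : x j k a * x i j p = x i k (-(p * a)) * (x i j p * x j k a) := by
    rw [h3, hx.map_neg hik]; group
  rw [SemiconjBy, ← mul_assoc, h5, sub_eq_neg_add, hx.map_add hik, mul_assoc, mul_assoc, h1.eq,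
    ← mul_assoc, ← (h4 _).eq]
  group

theorem semiconjBy_row' (hx : IsSteinberg x) {i j k : ι} (hij : i ≠ j) (hjk : j ≠ k) (hik : i ≠ k)
    (a p q : A) :
    SemiconjBy (x k j a) (x i j p * x i k q) (x i j (p - q * a) * x i k q) := by
  have h1 : ∀ p q : A, Commute (x i j p) (x i k q) :=
    fun p q => hx.commute hij hik hij.symm hik p q
  rw [(h1 _ _).eq, (h1 _ _).eq]
  exact hx.semiconjBy_row hik hjk.symm hij a q p

/-- A representative of a Weyl group element: it maps to the matrix with entries `u⁻¹` and `-u` in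
the places `(i, j)` and `(j, i)`. -/
def weyl (x : ι → ι → A → Q) (i j : ι) (u : Aˣ) : Q :=
  x j i (-u) * x i j ↑u⁻¹ * x j i (-u)

theorem semiconjBy_weyl_col (hx : IsSteinberg x) {i j k : ι} (hij : i ≠ j) (hjk : j ≠ k)
    (hik : i ≠ k) (u : Aˣ) (p q : A) :
    SemiconjBy (weyl x i j u) (x i k p * x j k q) (x i k (↑u⁻¹ * q) * x j k (-(u * p))) := by
  have h1 := hx.semiconjBy_col' hik.symm hij hjk.symm (-(u : A)) p q
  have h2 := hx.semiconjBy_col hik.symm hij hjk.symm (↑u⁻¹ : A) p (q + -(u : A) * p)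
  have h3 := hx.semiconjBy_col' hik.symm hij hjk.symm (-(u : A))
    (p + ↑u⁻¹ * (q + -(u : A) * p)) (q + -(u : A) * p)
  have h := (h3.mul_left (h2.mul_left h1))
  rw [← mul_assoc] at h
  have e1 : p + ↑u⁻¹ * (q + -(u : A) * p) = ↑u⁻¹ * q := by
    rw [mul_add, neg_mul, mul_neg, Units.inv_mul_cancel_left]; abel
  have e2 : q + -(u : A) * p + -(u : A) * (↑u⁻¹ * q) = -(u * p) := by
    rw [neg_mul (u : A) (_ * q), Units.mul_inv_cancel_left]; noncomm_ring
  rwa [e1, e2] at h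

theorem semiconjBy_weyl_row (hx : IsSteinberg x) {i j k : ι} (hij : i ≠ j) (hjk : j ≠ k)
    (hik : i ≠ k) (u : Aˣ) (p q : A) :
    SemiconjBy (weyl x i j u) (x k i p * x k j q) (x k i (q * u) * x k j (-(p * ↑u⁻¹))) := by
  have h1 := hx.semiconjBy_row' hik.symm hij hjk.symm (-(u : A)) p q
  have h2 := hx.semiconjBy_row hik.symm hij hjk.symm (↑u⁻¹ : A) (p - q * -(u : A)) q
  have h3 := hx.semiconjBy_row' hik.symm hij hjk.symm (-(u : A))
    (p - q * -(u : A)) (q - (p - q * -(u : A)) * ↑u⁻¹)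
  have h := (h3.mul_left (h2.mul_left h1))
  rw [← mul_assoc] at h
  have e1 : q - (p - q * -(u : A)) * ↑u⁻¹ = -(p * ↑u⁻¹) := by
    rw [mul_neg, sub_neg_eq_add, add_mul, Units.mul_inv_cancel_right]; abel
  have e2 : p - q * -(u : A) - -(p * ↑u⁻¹) * -(u : A) = q * u := by
    rw [neg_mul_neg, Units.inv_mul_cancel_right]; noncomm_ring
  rwa [e1, e2] at h

/-- Conjugation by a Weyl element exchanges `x i j` and `x j i`; this needs a third index, through
which `x i j a` is a commutator. -/
theorem weyl_one_conj_neg (hx : IsSteinberg x) {i j k : ι} (hij : i ≠ j) (hjk : j ≠ k)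
    (hik : i ≠ k) (a : A) : SemiconjBy (weyl x i j 1) (x j i (-a)) (x i j a) := by
  have h1 := hx.semiconjBy_weyl_row hij hjk hik 1 (-1) 0
  have h2 := hx.semiconjBy_weyl_col hij hjk hik 1 0 a
  have hik' := hik.symm
  have hjk' := hjk.symm
  simp only [hx.map_zero hik', hx.map_zero hjk', hx.map_zero hik, hx.map_zero hjk, mul_one, one_mul,
    mul_zero, neg_neg, neg_zero, Units.val_one, inv_one] at h1 h2
  have e : ∀ {i j k : ι}, i ≠ j → j ≠ k → i ≠ k → ∀ a b : A,
      x i k (a * b) = x i j a * x j k b * (x i j a)⁻¹ * (x j k b)⁻¹ := by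
    intro i j k hij hjk hik a b
    rw [hx.mul_comm' hij hjk hik]; group
  have h3 := (((h2.mul_right h1).mul_right h2.inv_right).mul_right h1.inv_right)
  rw [← e hjk hik' hij.symm, ← e hik hjk' hij] at h3
  simpa using h3

/-- When `u = 1 + γ d` is a unit, the element below lies over the diagonal matrix with entries `u`
and `(1 + d γ)⁻¹` in the places `j` and `k`. -/
def diagLift (x : ι → ι → A → Q) (j k : ι) (γ d : A) (u : Aˣ) : Q :=
  x k j (-(d * ↑u⁻¹)) * x j k γ * x k j d * x j k (-(↑u⁻¹ * γ))

theorem semiconjBy_diagLift_row (hx : IsSteinberg x) {i j k : ι} (hij : i ≠ j) (hjk : j ≠ k)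
    (hik : i ≠ k) {γ d : A} {u : Aˣ} (hu : (u : A) = 1 + γ * d) (b : A) :
    SemiconjBy (diagLift x j k γ d u) (x i j b) (x i j (b * ↑u⁻¹)) := by
  have e0 : (↑u⁻¹ : A) * γ * d = 1 - ↑u⁻¹ := by
    rw [mul_assoc, eq_sub_of_add_eq' hu.symm, mul_sub, Units.inv_mul, mul_one]
  have h1 := hx.semiconjBy_row hij hjk hik (-(↑u⁻¹ * γ)) b 0
  have e1 : 0 - b * -(↑u⁻¹ * γ) = b * ↑u⁻¹ * γ := by noncomm_ring
  have h2 := hx.semiconjBy_row' hij hjk hik d b (b * ↑u⁻¹ * γ)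
  have e2 : b - b * ↑u⁻¹ * γ * d = b * ↑u⁻¹ := by
    rw [mul_assoc, mul_assoc, ← mul_assoc _ γ, e0]; noncomm_ring
  have h3 := hx.semiconjBy_row hij hjk hik γ (b * ↑u⁻¹) (b * ↑u⁻¹ * γ)
  have h4 := hx.semiconjBy_row' hij hjk hik (-(d * ↑u⁻¹)) (b * ↑u⁻¹) 0
  rw [e1] at h1
  rw [e2] at h2
  rw [sub_self] at h3
  rw [zero_mul, sub_zero] at h4
  have h := h4.mul_left (h3.mul_left (h2.mul_left h1))
  rw [hx.map_zero hik, mul_one, mul_one, ← mul_assoc, ← mul_assoc] at h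
  exact h

theorem semiconjBy_diagLift_col (hx : IsSteinberg x) {i j k : ι} (hij : i ≠ j) (hjk : j ≠ k)
    (hik : i ≠ k) {γ d : A} {u : Aˣ} (hu : (u : A) = 1 + γ * d) (b : A) :
    SemiconjBy (diagLift x j k γ d u) (x j i b) (x j i (u * b)) := by
  have h1 := hx.semiconjBy_col hij hjk hik (-(↑u⁻¹ * γ)) b 0
  have h2 := hx.semiconjBy_col' hij hjk hik d b 0
  have h3 := hx.semiconjBy_col hij hjk hik γ b (d * b)
  have e3 : b + γ * (d * b) = u * b := by rw [hu]; noncomm_ring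
  have h4 := hx.semiconjBy_col' hij hjk hik (-(d * ↑u⁻¹)) (u * b) (d * b)
  have e4 : d * b + -(d * ↑u⁻¹) * (u * b) = 0 := by
    rw [neg_mul, mul_assoc, Units.inv_mul_cancel_left, add_neg_cancel]
  rw [mul_zero, add_zero] at h1
  rw [zero_add] at h2
  rw [e3] at h3
  rw [e4] at h4
  have h := h4.mul_left (h3.mul_left (h2.mul_left h1))
  rw [hx.map_zero hik.symm, mul_one, mul_one, ← mul_assoc, ← mul_assoc] at h
  exact h

/-- The lifts of a diagonal matrix for the index pairs `(i, k)` and `(j, k)` differ by the product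
of two Weyl elements for the pair `(i, j)`: conjugate the second lift by a Weyl element, on which
it acts linearly. -/
theorem diagLift_eq (hx : IsSteinberg x) {i j k : ι} (hij : i ≠ j) (hjk : j ≠ k)
    (hik : i ≠ k) {γ d : A} {u : Aˣ} (hu : (u : A) = 1 + γ * d) :
    diagLift x i k γ d u = weyl x i j 1 * (weyl x i j u)⁻¹ * diagLift x j k γ d u := by
  have hD : SemiconjBy (diagLift x j k γ d u) (weyl x i j 1) (weyl x i j u) := by
    have h1 := hx.semiconjBy_diagLift_col hij hjk hik hu (-1)
    have h2 := hx.semiconjBy_diagLift_row hij hjk hik hu 1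
    have h := (h1.mul_right h2).mul_right h1
    rw [mul_neg, mul_one, one_mul] at h
    simpa [weyl] using h
  have hc : ∀ b, SemiconjBy (weyl x i j 1) (x j k b) (x i k b) := fun b => by
    have h := hx.semiconjBy_weyl_col hij hjk hik 1 0 b
    simpa [hx.map_zero hik, hx.map_zero hjk] using h
  have hr : ∀ b, SemiconjBy (weyl x i j 1) (x k j b) (x k i b) := fun b => by
    have h := hx.semiconjBy_weyl_row hij hjk hik 1 0 b
    simpa [hx.map_zero hik.symm, hx.map_zero hjk.symm] using h
  have hw : SemiconjBy (weyl x i j 1) (diagLift x j k γ d u) (diagLift x i k γ d u) :=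
    (((hr _).mul_right (hc _)).mul_right (hr _)).mul_right (hc _)
  have h1 : diagLift x i k γ d u = weyl x i j 1 * diagLift x j k γ d u * (weyl x i j 1)⁻¹ :=
    eq_mul_inv_of_mul_eq hw.eq.symm
  have h2 : weyl x i j u = diagLift x j k γ d u * weyl x i j 1 * (diagLift x j k γ d u)⁻¹ :=
    eq_mul_inv_of_mul_eq hD.eq.symm
  rw [h1, h2]
  group

/-- The rank one identity behind the finiteness theorem: modulo a subgroup `P` containing the row
subgroup of `k` and the elements with indices `i`, `j`, left multiplication by `x i k γ` can be
traded for left multiplication by an element not involving the index `k`. -/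
theorem exists_mul_eq_weyl_mul (hx : IsSteinberg x) {i j k : ι} (hij : i ≠ j) (hjk : j ≠ k)
    (hik : i ≠ k) {γ d : A} {u : Aˣ} (hu : (u : A) = 1 + γ * d) {P : Subgroup Q}
    (hki : ∀ a, x k i a ∈ P) (hPij : ∀ a, x i j a ∈ P) (hji : ∀ a, x j i a ∈ P) :
    ∃ p ∈ P, x i k γ * (x k i (d - 1) * x i k 1) =
      weyl x i j 1 * (weyl x i j u)⁻¹ * (x k i (d - 1) * x i k 1) * p := by
  set h := weyl x i j 1 * (weyl x i j u)⁻¹ with hh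
  set w := weyl x i k 1 with hw
  have f1 : x k i (d - 1) * x i k 1 = x k i d * w * x k i 1 := by
    rw [hw, weyl, sub_eq_add_neg, hx.map_add hik.symm]
    simp only [Units.val_one, inv_one, hx.map_neg hik.symm]
    group
  have f2 : x i k γ * x k i d = x k i (d * ↑u⁻¹) * h * diagLift x j k γ d u * x i k (↑u⁻¹ * γ) := by
    rw [mul_assoc _ h, hh, ← hx.diagLift_eq hij hjk hik hu, diagLift]
    simp only [hx.map_neg hik.symm, hx.map_neg hik]
    group
  have f3 : SemiconjBy h (x k i d) (x k i (d * ↑u⁻¹)) := by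
    have a1 := hx.semiconjBy_weyl_row hij hjk hik 1 0 (d * ↑u⁻¹)
    have a2 := hx.semiconjBy_weyl_row hij hjk hik u 0 (d * ↑u⁻¹)
    simp only [hx.map_zero hik.symm, hx.map_zero hjk.symm, one_mul, mul_one, zero_mul, neg_zero,
      Units.inv_mul_cancel_right, Units.val_one] at a1 a2
    exact a1.mul_left a2.inv_symm_left
  have hik' := hik.symm
  have hjk' := hjk.symm
  have g1 : ∀ a, SemiconjBy w (x j i (-a)) (x j k a) := fun a => by
    have := hx.semiconjBy_weyl_row hik hjk' hij 1 (-a) 0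
    simpa [hx.map_zero hij.symm, hx.map_zero hjk] using this
  have g2 : ∀ a, SemiconjBy w (x i j (-a)) (x k j a) := fun a => by
    have := hx.semiconjBy_weyl_col hik hjk' hij 1 (-a) 0
    simpa [hx.map_zero hij, hx.map_zero hjk'] using this
  have g3 : ∀ a, SemiconjBy w (x k i (-a)) (x i k a) := fun a =>
    hx.weyl_one_conj_neg hik hjk' hij a
  obtain ⟨q, hq, hqw⟩ : ∃ q ∈ P, SemiconjBy w q (diagLift x j k γ d u * x i k (↑u⁻¹ * γ)) :=
    ⟨_, mul_mem (mul_mem (mul_mem (mul_mem (hPij _) (hji _)) (hPij _)) (hji _)) (hki _),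
      ((((g2 _).mul_right (g1 _)).mul_right (g2 _)).mul_right (g1 _)).mul_right (g3 _)⟩
  refine ⟨(x k i 1)⁻¹ * q * x k i 1, mul_mem (mul_mem (inv_mem (hki _)) hq) (hki _), ?_⟩
  calc x i k γ * (x k i (d - 1) * x i k 1)
      = (x i k γ * x k i d) * w * x k i 1 := by rw [f1]; group
    _ = (x k i (d * ↑u⁻¹) * h) * ((diagLift x j k γ d u * x i k (↑u⁻¹ * γ)) * w) * x k i 1 := by
        rw [f2]; group
    _ = (h * x k i d) * (w * q) * x k i 1 := by rw [f3.eq, hqw.eq]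
    _ = h * (x k i (d - 1) * x i k 1) * ((x k i 1)⁻¹ * q * x k i 1) := by rw [f1]; group

end IsSteinberg

/-! ### Columns, rows and the matrices acting on them -/

theorem elementaryUnit_mulVec {k : ℕ} {A : Type*} [Ring A] {i j : Fin k} (hij : i ≠ j) (a : A)
    (v : Fin k → A) :
    (elementaryUnit i j hij a).1 *ᵥ v = v + Pi.single i (a * v j) := by
  ext l
  simp [elementaryUnit, Matrix.add_mulVec, Matrix.single_mulVec, Pi.single_apply,
    Function.update_apply]

theorem vecMul_elementaryUnit {k : ℕ} {A : Type*} [Ring A] {i j : Fin k} (hij : i ≠ j) (a : A)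
    (v : Fin k → A) :
    v ᵥ* (elementaryUnit i j hij a).1 = v + Pi.single j (v i * a) := by
  ext l
  rw [elementaryUnit, Matrix.vecMul_add, Matrix.vecMul_one]
  simp [Matrix.vecMul, dotProduct, Matrix.single_apply, Pi.single_apply, ite_and, eq_comm]

namespace IsSteinberg

variable {A Q : Type*} [Ring A] [Group Q] {k : ℕ} {x : Option (Fin k) → Option (Fin k) → A → Q}

/-- The product of the commuting elements `x (some i) none (v i)`. -/
def col (hx : IsSteinberg x) (v : Fin k → A) : Q :=
  MonoidHom.noncommPiCoprod (N := fun _ : Fin k => Multiplicative A)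
    (fun i =>
      { toFun := fun a => x (some i) none a.toAdd
        map_one' := hx.map_zero (Option.some_ne_none i)
        map_mul' := fun _ _ => hx.map_add (Option.some_ne_none i) _ _ })
    (fun i j _ _ _ => hx.commute (Option.some_ne_none i) (Option.some_ne_none j)
      (Option.some_ne_none j).symm (Option.some_ne_none i) _ _)
    (fun i => Multiplicative.ofAdd (v i))

/-- The product of the commuting elements `x none (some i) (v i)`. -/
def row (hx : IsSteinberg x) (v : Fin k → A) : Q :=
  MonoidHom.noncommPiCoprod (N := fun _ : Fin k => Multiplicative A)
    (fun i =>
      { toFun := fun a => x none (some i) a.toAdd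
        map_one' := hx.map_zero (Option.some_ne_none i).symm
        map_mul' := fun _ _ => hx.map_add (Option.some_ne_none i).symm _ _ })
    (fun i j _ _ _ => hx.commute (Option.some_ne_none i).symm (Option.some_ne_none j).symm
      (Option.some_ne_none i) (Option.some_ne_none j).symm _ _)
    (fun i => Multiplicative.ofAdd (v i))

theorem col_add (hx : IsSteinberg x) (v w : Fin k → A) :
    hx.col (v + w) = hx.col v * hx.col w := by
  rw [col, col, col, ← map_mul]; rfl

theorem row_add (hx : IsSteinberg x) (v w : Fin k → A) :
    hx.row (v + w) = hx.row v * hx.row w := by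
  rw [row, row, row, ← map_mul]; rfl

theorem col_zero (hx : IsSteinberg x) : hx.col 0 = 1 := by
  have := hx.col_add 0 0
  rwa [add_zero, left_eq_mul] at this

theorem row_zero (hx : IsSteinberg x) : hx.row 0 = 1 := by
  have := hx.row_add 0 0
  rwa [add_zero, left_eq_mul] at this

theorem col_neg (hx : IsSteinberg x) (v : Fin k → A) : hx.col (-v) = (hx.col v)⁻¹ := by
  rw [eq_inv_iff_mul_eq_one, ← hx.col_add, neg_add_cancel, hx.col_zero]

theorem row_neg (hx : IsSteinberg x) (v : Fin k → A) : hx.row (-v) = (hx.row v)⁻¹ := by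
  rw [eq_inv_iff_mul_eq_one, ← hx.row_add, neg_add_cancel, hx.row_zero]

theorem row_comm (hx : IsSteinberg x) (v w : Fin k → A) :
    hx.row v * hx.row w = hx.row w * hx.row v := by
  rw [← hx.row_add, ← hx.row_add, add_comm]

theorem col_single (hx : IsSteinberg x) (i : Fin k) (a : A) :
    hx.col (Pi.single i a) = x (some i) none a := by
  rw [col]
  have : (fun j => Multiplicative.ofAdd ((Pi.single i a : Fin k → A) j)) =
      Pi.mulSingle (M := fun _ : Fin k => Multiplicative A) i (Multiplicative.ofAdd a) := by
    ext j
    by_cases h : j = i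
    · subst h; simp
    · simp [h]
  rw [this]
  exact MonoidHom.noncommPiCoprod_mulSingle (N := fun _ : Fin k => Multiplicative A) _ i
    (Multiplicative.ofAdd a)

theorem row_single (hx : IsSteinberg x) (i : Fin k) (a : A) :
    hx.row (Pi.single i a) = x none (some i) a := by
  rw [row]
  have : (fun j => Multiplicative.ofAdd ((Pi.single i a : Fin k → A) j)) =
      Pi.mulSingle (M := fun _ : Fin k => Multiplicative A) i (Multiplicative.ofAdd a) := by
    ext j
    by_cases h : j = i
    · subst h; simp
    · simp [h]
  rw [this]
  exact MonoidHom.noncommPiCoprod_mulSingle (N := fun _ : Fin k => Multiplicative A) _ i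
    (Multiplicative.ofAdd a)

theorem semiconjBy_col_elem (hx : IsSteinberg x) {i j : Fin k} (hij : i ≠ j) (a : A)
    (v : Fin k → A) :
    SemiconjBy (x (some i) (some j) a) (hx.col v) (hx.col (v + Pi.single i (a * v j))) := by
  have hij' : some i ≠ some j := by simpa using hij
  induction v using Pi.single_induction with
  | zero => simp [col_zero]
  | add v w hv hw =>
    have : v + w + Pi.single i (a * (v + w) j) =
        (v + Pi.single i (a * v j)) + (w + Pi.single i (a * w j)) := by
      rw [Pi.add_apply, mul_add, Pi.single_add]; abel
    rw [this, col_add, col_add]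
    exact hv.mul_right hw
  | single l b =>
    rw [col_add, hx.col_single, hx.col_single]
    by_cases h : l = j
    · subst h
      rw [Pi.single_eq_same, SemiconjBy, hx.mul_comm' hij' (by simp) (by simp), ← mul_assoc,
        (hx.commute (by simp) (by simp) (by simp) (by simp) _ _).eq]
    · rw [Pi.single_eq_of_ne (Ne.symm h), mul_zero, hx.map_zero (by simp), mul_one]
      exact hx.commute hij' (by simp) (by simpa using Ne.symm h) (by simp) _ _

theorem semiconjBy_row_elem (hx : IsSteinberg x) {i j : Fin k} (hij : i ≠ j) (a : A)
    (v : Fin k → A) :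
    SemiconjBy (x (some i) (some j) a) (hx.row (v + Pi.single j (v i * a))) (hx.row v) := by
  have hij' : some i ≠ some j := by simpa using hij
  induction v using Pi.single_induction with
  | zero => simp [row_zero]
  | add v w hv hw =>
    have : v + w + Pi.single j ((v + w) i * a) =
        (v + Pi.single j (v i * a)) + (w + Pi.single j (w i * a)) := by
      rw [Pi.add_apply, add_mul, Pi.single_add]; abel
    rw [this, hx.row_add (v + _), hx.row_add v w]
    exact hv.mul_right hw
  | single l b =>
    rw [row_add, hx.row_single, hx.row_single]
    by_cases h : l = i
    · subst h
      have h1 := hx.mul_comm' (i := none) (by simp) hij' (by simp) b a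
      have h2 : Commute (x (some l) (some j) a) (x none (some j) (b * a)) :=
        hx.commute hij' (by simp) (by simp) hij' _ _
      have h3 : Commute (x none (some l) b) (x none (some j) (b * a)) :=
        hx.commute (by simp) (by simp) (by simp) (by simp) _ _
      rw [Pi.single_eq_same, SemiconjBy, h3.eq, ← mul_assoc, h2.eq, mul_assoc, h1]
    · rw [Pi.single_eq_of_ne (Ne.symm h), zero_mul, hx.map_zero (by simp), mul_one]
      exact hx.commute hij' (by simp) (by simp) (by simpa using Ne.symm h) _ _

/-- The group element `m` normalizes the column and the row subgroup, and its conjugation action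
on them is that of the invertible matrix `g`. -/
structure Acts (hx : IsSteinberg x) (m : Q) (g : GL (Fin k) A) : Prop where
  col : ∀ v, SemiconjBy m (hx.col v) (hx.col (g.1 *ᵥ v))
  row : ∀ v, SemiconjBy m (hx.row (v ᵥ* g.1)) (hx.row v)

namespace Acts

variable {hx : IsSteinberg x} {m m' : Q} {g g' : GL (Fin k) A}

theorem one : hx.Acts 1 1 := ⟨fun v => by simp, fun v => by simp⟩

theorem mul (h : hx.Acts m g) (h' : hx.Acts m' g') : hx.Acts (m * m') (g * g') where
  col v := by
    rw [Units.val_mul, ← Matrix.mulVec_mulVec]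
    exact (h.col _).mul_left (h'.col v)
  row v := by
    rw [Units.val_mul, ← Matrix.vecMul_vecMul]
    exact (h.row _).mul_left (h'.row _)

theorem inv (h : hx.Acts m g) : hx.Acts m⁻¹ g⁻¹ where
  col v := by
    have := h.col (g⁻¹.1 *ᵥ v)
    rw [Matrix.mulVec_mulVec, ← Units.val_mul, mul_inv_cancel, Units.val_one,
      Matrix.one_mulVec] at this
    exact this.inv_symm_left
  row v := by
    have := h.row (v ᵥ* g⁻¹.1)
    rw [Matrix.vecMul_vecMul, ← Units.val_mul, inv_mul_cancel, Units.val_one,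
      Matrix.vecMul_one] at this
    exact this.inv_symm_left

theorem mul_row (h : hx.Acts m g) (v : Fin k → A) :
    m * hx.row v = hx.row (v ᵥ* g⁻¹.1) * m := by
  have := (h.row (v ᵥ* g⁻¹.1)).eq
  rwa [Matrix.vecMul_vecMul, ← Units.val_mul, inv_mul_cancel, Units.val_one,
    Matrix.vecMul_one] at this

theorem mul_col_inv (h : hx.Acts m g) (v : Fin k → A) :
    m * hx.col (g⁻¹.1 *ᵥ v) = hx.col v * m := by
  have := (h.col (g⁻¹.1 *ᵥ v)).eq
  rwa [Matrix.mulVec_mulVec, ← Units.val_mul, mul_inv_cancel, Units.val_one,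
    Matrix.one_mulVec] at this

end Acts

theorem acts_elem (hx : IsSteinberg x) {i j : Fin k} (hij : i ≠ j) (a : A) :
    hx.Acts (x (some i) (some j) a) (elementaryUnit i j hij a) where
  col v := by
    rw [elementaryUnit_mulVec]
    exact hx.semiconjBy_col_elem hij a v
  row v := by
    rw [vecMul_elementaryUnit]
    exact hx.semiconjBy_row_elem hij a v

/-- Column operations with a fixed pivot `o`, together with the commutation rule that produces
them. -/
theorem exists_acts_pivot_col (hx : IsSteinberg x) (o : Fin k) (s : A) (γ : Fin k → A)
    (hγ : γ o = 0) :
    ∃ m g, hx.Acts m g ∧ (∀ v, g.1 *ᵥ v = v + fun i => γ i * s * v o) ∧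
      hx.col γ * x none (some o) s = x none (some o) s * (hx.col γ * m) := by
  suffices H : ∀ S : Finset (Fin k), o ∉ S →
      ∃ m g, hx.Acts m g ∧
        (∀ v, g.1 *ᵥ v = v + fun i => if i ∈ S then γ i * s * v o else 0) ∧
        hx.col (fun i => if i ∈ S then γ i else 0) * x none (some o) s =
          x none (some o) s * (hx.col (fun i => if i ∈ S then γ i else 0) * m) by
    obtain ⟨m, g, hm, hg, hc⟩ := H (Finset.univ.erase o) (by simp)
    have e : (fun i => if i ∈ Finset.univ.erase o then γ i else 0) = γ := by
      ext i
      by_cases h : i = o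
      · subst h; simp [hγ]
      · simp [h]
    rw [e] at hc
    refine ⟨m, g, hm, fun v => ?_, hc⟩
    rw [hg v]
    congr 1
    ext i
    by_cases h : i = o
    · subst h; simp [hγ]
    · simp [h]
  intro S
  induction S using Finset.induction_on with
  | empty =>
    intro _
    refine ⟨1, 1, Acts.one, fun v => by ext i; simp, ?_⟩
    have : (fun i => if i ∈ (∅ : Finset (Fin k)) then γ i else 0) = 0 := by ext i; simp
    rw [this, col_zero]; simp
  | insert j S hj ih =>
    intro ho
    rw [Finset.mem_insert, not_or] at ho
    obtain ⟨m, g, hm, hg, hc⟩ := ih ho.2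
    have hjo : j ≠ o := Ne.symm ho.1
    have hjo' : some j ≠ some o := by simpa using hjo
    refine ⟨m * x (some j) (some o) (γ j * s), g * elementaryUnit j o hjo (γ j * s),
      hm.mul (hx.acts_elem hjo _), fun v => ?_, ?_⟩
    · rw [Units.val_mul, ← Matrix.mulVec_mulVec, elementaryUnit_mulVec, hg]
      ext i
      by_cases h : i = j
      · subst h; simp [hj, ho.1]
      · simp [h, Ne.symm hjo]
    · have e : (fun i => if i ∈ insert j S then γ i else 0) =
          (fun i => if i ∈ S then γ i else 0) + Pi.single j (γ j) := by
        ext i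
        by_cases h : i = j
        · subst h; simp [hj]
        · simp [h]
      have h1 : SemiconjBy m (x (some j) none (γ j)) (x (some j) none (γ j)) := by
        have h := hm.col (Pi.single j (γ j))
        rw [hg, hx.col_single] at h
        have h0 : (Pi.single j (γ j) + fun i =>
            if i ∈ S then γ i * s * (Pi.single j (γ j) : Fin k → A) o else 0) =
            Pi.single j (γ j) := by
          ext i; simp [ho.1]
        rwa [h0, hx.col_single] at h
      have h2 : x (some j) none (γ j) * x none (some o) s =
          x none (some o) s * x (some j) none (γ j) * x (some j) (some o) (γ j * s) := by
        have h := hx.mul_comm' (i := some j) (j := none) (k := some o) (by simp) (by simp) hjo'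
          (γ j) s
        rw [h, ((hx.commute hjo' (by simp) (by simp) hjo' _ _).mul_right
          (hx.commute hjo' (by simp) hjo'.symm (by simp) _ _)).eq]
      rw [e, hx.col_add, hx.col_single, mul_assoc, h2, ← mul_assoc, ← mul_assoc, hc]
      calc _ = x none (some o) s * hx.col (fun i => if i ∈ S then γ i else 0) *
            (m * x (some j) none (γ j)) * x (some j) (some o) (γ j * s) := by group
        _ = _ := by rw [h1.eq]; group

/-- Row operations with a fixed target `o`. -/
theorem exists_acts_pivot_row (hx : IsSteinberg x) (o : Fin k) (t : Fin k → A) (ht : t o = 0) :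
    ∃ m g, hx.Acts m g ∧ ∀ v, g.1 *ᵥ v = v + Pi.single o (∑ i, t i * v i) := by
  suffices H : ∀ S : Finset (Fin k), o ∉ S →
      ∃ m g, hx.Acts m g ∧ ∀ v, g.1 *ᵥ v = v + Pi.single o (∑ i ∈ S, t i * v i) by
    obtain ⟨m, g, hm, hg⟩ := H (Finset.univ.erase o) (by simp)
    refine ⟨m, g, hm, fun v => ?_⟩
    rw [hg v, Finset.sum_erase _ (by rw [ht, zero_mul])]
  intro S
  induction S using Finset.induction_on with
  | empty => exact fun _ => ⟨1, 1, Acts.one, fun v => by simp⟩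
  | insert j S hj ih =>
    intro ho
    rw [Finset.mem_insert, not_or] at ho
    obtain ⟨m, g, hm, hg⟩ := ih ho.2
    refine ⟨x (some o) (some j) (t j) * m, elementaryUnit o j ho.1 (t j) * g,
      (hx.acts_elem ho.1 _).mul hm, fun v => ?_⟩
    rw [Units.val_mul, ← Matrix.mulVec_mulVec, hg, elementaryUnit_mulVec, Finset.sum_insert hj]
    have : (v + Pi.single o (∑ i ∈ S, t i * v i) : Fin k → A) j = v j := by simp [Ne.symm ho.1]
    rw [this, add_assoc, ← Pi.single_add, add_comm (∑ i ∈ S, t i * v i)]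

/-- Columns that are the image of a basis vector under the matrix of some element. -/
theorem exists_acts_mulVec_eq_single (hx : IsSteinberg x) {o l : Fin k} (u : Aˣ)
    (hol : o ≠ l) : ∃ m g, hx.Acts m g ∧ g.1 *ᵥ Pi.single o 1 = Pi.single l (u : A) := by
  refine ⟨_, _, (hx.acts_elem hol (-↑u⁻¹)).mul (hx.acts_elem hol.symm (u : A)), ?_⟩
  rw [Units.val_mul, ← Matrix.mulVec_mulVec, elementaryUnit_mulVec, elementaryUnit_mulVec]
  ext i
  by_cases h : i = o
  · subst h; simp [hol.symm]
  · by_cases h' : i = l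
    · subst h'; simp [hol.symm]
    · simp [h, h']

/-- A column one of whose entries becomes a unit after adding multiples of the other entries is
the image of a basis vector. -/
theorem exists_acts_mulVec_eq (hx : IsSteinberg x) (hk : 2 ≤ k) (o l : Fin k) (v t : Fin k → A)
    (ht : t l = 0) (hu : IsUnit (v l + ∑ i, t i * v i)) :
    ∃ m g, hx.Acts m g ∧ g.1 *ᵥ Pi.single o 1 = v := by
  obtain ⟨u, hu⟩ := hu
  have hnt : Nontrivial (Fin k) := Fin.nontrivial_iff_two_le.2 hk
  obtain ⟨m₁, g₁, h₁, hg₁⟩ : ∃ m g, hx.Acts m g ∧ g.1 *ᵥ Pi.single o 1 = Pi.single l (u : A) := by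
    by_cases hol : o = l
    · subst hol
      obtain ⟨l, hl⟩ := exists_ne o
      obtain ⟨m, g, h, hg⟩ := hx.exists_acts_mulVec_eq_single 1 hl.symm
      obtain ⟨m', g', h', hg'⟩ := hx.exists_acts_mulVec_eq_single u hl
      refine ⟨_, _, h'.mul h, ?_⟩
      rw [Units.val_mul, ← Matrix.mulVec_mulVec, hg, Units.val_one, hg']
    · exact hx.exists_acts_mulVec_eq_single u hol
  obtain ⟨m₂, g₂, h₂, hg₂, -⟩ := hx.exists_acts_pivot_col l (↑u⁻¹ : A)
    (fun i => if i = l then 0 else v i) (by simp)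
  obtain ⟨m₃, g₃, h₃, hg₃⟩ := hx.exists_acts_pivot_row l (fun i => - t i) (by simp [ht])
  refine ⟨_, _, h₃.mul (h₂.mul h₁), ?_⟩
  rw [Units.val_mul, Units.val_mul, ← Matrix.mulVec_mulVec, ← Matrix.mulVec_mulVec, hg₁, hg₂]
  have e : (Pi.single l (u : A) + fun i =>
      (if i = l then 0 else v i) * (↑u⁻¹ : A) * (Pi.single l (u : A) : Fin k → A) l) =
      v + Pi.single l (∑ i, t i * v i) := by
    ext i
    by_cases h : i = l
    · subst h; simp [hu]
    · simp [h]
  rw [e, hg₃]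
  have e2 : ∑ i, -t i * (v + Pi.single l (∑ i, t i * v i) : Fin k → A) i = - ∑ i, t i * v i := by
    rw [← Finset.sum_neg_distrib]
    refine Finset.sum_congr rfl fun i _ => ?_
    by_cases h : i = l
    · subst h; simp [ht]
    · simp [h]
  rw [e2, Pi.single_neg, add_neg_cancel_right]

end IsSteinberg

/-! ### Cosets of a parabolic subgroup -/

namespace IsSteinberg

section Cosets

variable {A Q : Type*} [Ring A] [Group Q] {k : ℕ} {x : Option (Fin k) → Option (Fin k) → A → Q}

/-- The abelian subgroup formed by the rows. -/
def rowGroup (hx : IsSteinberg x) : Subgroup Q where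
  carrier := Set.range hx.row
  mul_mem' := by
    rintro _ _ ⟨v, rfl⟩ ⟨w, rfl⟩
    exact ⟨v + w, hx.row_add v w⟩
  one_mem' := ⟨0, hx.row_zero⟩
  inv_mem' := by
    rintro _ ⟨v, rfl⟩
    exact ⟨-v, hx.row_neg v⟩

/-- The normalizer of the row subgroup, which plays the role of a maximal parabolic subgroup. -/
def parabolic (hx : IsSteinberg x) : Subgroup Q :=
  Subgroup.normalizer (hx.rowGroup : Set Q)

theorem row_mem_rowGroup (hx : IsSteinberg x) (v : Fin k → A) : hx.row v ∈ hx.rowGroup := ⟨v, rfl⟩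

theorem row_mem_parabolic (hx : IsSteinberg x) (v : Fin k → A) : hx.row v ∈ hx.parabolic :=
  Subgroup.le_normalizer (hx.row_mem_rowGroup v)

theorem Acts.mem_parabolic {hx : IsSteinberg x} {m : Q} {g : GL (Fin k) A} (h : hx.Acts m g) :
    m ∈ hx.parabolic := by
  rw [parabolic, Subgroup.mem_normalizer_iff]
  intro q
  constructor
  · rintro ⟨v, rfl⟩
    exact ⟨v ᵥ* g⁻¹.1, eq_mul_inv_of_mul_eq (h.mul_row v).symm⟩
  · rintro ⟨v, hv⟩
    refine ⟨v ᵥ* g.1, ?_⟩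
    have := (h.row v).eq
    rw [hv] at this
    simpa using this

/-- The representative of the coset of the parabolic subgroup whose last column is the basis vector
`o` followed by the entry `d`. If `m` acts by `g`, then `m * base x o d` has the last column
`g *ᵥ Pi.single o 1` followed by `d`, and modulo the parabolic subgroup it depends on nothing
else. -/
def base (x : Option (Fin k) → Option (Fin k) → A → Q) (o : Fin k) (d : A) : Q :=
  x none (some o) (d - 1) * x (some o) none 1

theorem mk_mul_congr {P : Subgroup Q} {y z : Q} (h : (y : Q ⧸ P) = z) (q : Q) :
    ((q * y : Q) : Q ⧸ P) = (q * z : Q) := by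
  rw [QuotientGroup.eq] at h ⊢
  rwa [_root_.mul_inv_rev, mul_assoc, inv_mul_cancel_left]

/-- Rows vanishing in the place `o` are carried into the parabolic subgroup by the column element
that `base x o d` ends with. -/
theorem inv_mul_row_update_mul_mem (hx : IsSteinberg x) (o : Fin k) (ρ : Fin k → A) :
    (x (some o) none 1)⁻¹ * (hx.row (Function.update ρ o 0) * x (some o) none 1) ∈
      hx.parabolic := by
  induction ρ using Pi.single_induction with
  | zero =>
    have : Function.update (0 : Fin k → A) o 0 = 0 := Function.update_eq_self o 0
    simp [this, hx.row_zero]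
  | add v w hv hw =>
    have : Function.update (v + w) o 0 = Function.update v o 0 + Function.update w o 0 := by
      rw [← Function.update_add, add_zero]
    rw [this, hx.row_add]
    convert mul_mem hv hw using 1
    group
  | single j b =>
    by_cases h : j = o
    · subst h
      have : Function.update (Pi.single j b : Fin k → A) j 0 = 0 := by
        ext i; by_cases h : i = j
        · subst h; simp
        · simp [h]
      simp [this, hx.row_zero]
    · have : Function.update (Pi.single j b : Fin k → A) o 0 = Pi.single j b := by
        ext i; by_cases h' : i = o
        · subst h'; simp [Ne.symm h]
        · simp [h']
      have hjo : o ≠ j := Ne.symm h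
      have h1 := hx.mul_comm' (i := some o) (j := none) (k := some j) (by simp) (by simp)
        (by simpa using hjo) 1 b
      have h2 : Commute (x (some o) none 1) (x (some o) (some j) (1 * b)) :=
        hx.commute (by simp) (by simpa using hjo) (by simp) (by simpa using hjo) _ _
      have h3 : x none (some j) b * x (some o) none 1 = x (some o) none 1 *
          ((x (some o) (some j) (1 * b))⁻¹ * x none (some j) b) := by
        rw [← mul_assoc, h2.inv_right.eq, mul_assoc, h1, inv_mul_cancel_left]
      rw [this, hx.row_single, h3, inv_mul_cancel_left]
      exact mul_mem (inv_mem (hx.acts_elem hjo _).mem_parabolic)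
        (hx.row_single j b ▸ hx.row_mem_parabolic _)

/-- Left multiplication by a row only changes the last entry of the last column. -/
theorem mk_row_mul_base (hx : IsSteinberg x) {m : Q} {g : GL (Fin k) A} (h : hx.Acts m g)
    (o : Fin k) (ρ : Fin k → A) (d : A) :
    ((hx.row ρ * (m * base x o d) : Q) : Q ⧸ hx.parabolic) =
      (m * base x o (d + (ρ ᵥ* g.1) o) : Q) := by
  set σ := ρ ᵥ* g.1 with hσ
  have e : σ = Pi.single o (σ o) + Function.update σ o 0 := by
    ext i; by_cases h : i = o
    · subst h; simp
    · simp [h]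
  have e2 : base x o (d + σ o) = x none (some o) (σ o) * base x o d := by
    rw [base, base, ← mul_assoc, ← hx.map_add (by simp)]
    congr 2; abel
  have e3 : hx.row ρ * (m * base x o d) = m * base x o (d + σ o) *
      ((x (some o) none 1)⁻¹ * (hx.row (Function.update σ o 0) * x (some o) none 1)) := by
    calc hx.row ρ * (m * base x o d) = m * hx.row σ * base x o d := by
          rw [← mul_assoc, (h.row ρ).eq]
      _ = m * x none (some o) (σ o) * (hx.row (Function.update σ o 0) *
            hx.row (Pi.single o (d - 1))) * x (some o) none 1 := by
          conv_lhs => rw [e, hx.row_add, hx.row_single]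
          rw [base, hx.row_single]
          group
      _ = _ := by
          rw [hx.row_comm, e2, base, hx.row_single]
          group
  rw [e3]
  exact QuotientGroup.mk_mul_of_mem _ (hx.inv_mul_row_update_mul_mem o σ)

theorem mk_mul_base_of_fixed (hx : IsSteinberg x) {m : Q} {g : GL (Fin k) A} (h : hx.Acts m g)
    {o : Fin k} (hg : g.1 *ᵥ Pi.single o 1 = Pi.single o 1) (d : A) :
    ((m * base x o d : Q) : Q ⧸ hx.parabolic) = (base x o d : Q) := by
  have hg' : g⁻¹.1 *ᵥ Pi.single o 1 = Pi.single o 1 := by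
    conv_lhs => rw [← hg]
    rw [Matrix.mulVec_mulVec, ← Units.val_mul, inv_mul_cancel, Units.val_one, Matrix.one_mulVec]
  have e1 : m * x none (some o) (d - 1) = hx.row (Pi.single o (d - 1) ᵥ* g⁻¹.1) * m := by
    rw [← hx.row_single, h.mul_row]
  have e2 : m * x (some o) none 1 = x (some o) none 1 * m := by
    have := (h.col (Pi.single o 1)).eq
    rwa [hg, hx.col_single] at this
  have e3 : m * base x o d =
      hx.row (Pi.single o (d - 1) ᵥ* g⁻¹.1) * (1 * base x o 1) * m := by
    rw [base, base, sub_self, hx.map_zero (by simp), ← mul_assoc, e1, mul_assoc, e2]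
    group
  have e4 : ((Pi.single o (d - 1) ᵥ* g⁻¹.1) ᵥ* (1 : GL (Fin k) A).1) o = d - 1 := by
    have := Matrix.dotProduct_mulVec (Pi.single o (d - 1)) g⁻¹.1 (Pi.single o (1 : A))
    rw [hg'] at this
    simpa using this.symm
  rw [e3, QuotientGroup.mk_mul_of_mem _ h.mem_parabolic, hx.mk_row_mul_base Acts.one, e4, one_mul,
    add_sub_cancel]

theorem mk_mul_base_eq (hx : IsSteinberg x) {m m' : Q} {g g' : GL (Fin k) A} (h : hx.Acts m g)
    (h' : hx.Acts m' g') {o : Fin k} (hg : g.1 *ᵥ Pi.single o 1 = g'.1 *ᵥ Pi.single o 1) (d : A) :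
    ((m * base x o d : Q) : Q ⧸ hx.parabolic) = (m' * base x o d : Q) := by
  have := hx.mk_mul_base_of_fixed (h'.inv.mul h) (o := o) (d := d) (by
    rw [Units.val_mul, ← Matrix.mulVec_mulVec, hg, Matrix.mulVec_mulVec, ← Units.val_mul,
      inv_mul_cancel, Units.val_one, Matrix.one_mulVec])
  have := mk_mul_congr this m'
  rwa [← mul_assoc, mul_inv_cancel_left] at this

/-- The case of columns that do not meet the pivot `o`: they commute with the row element in
`base x o d` up to a column operation with pivot `o`. -/
theorem exists_mk_col_mul_base_of_eq_zero (hx : IsSteinberg x) {o : Fin k} (d : A)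
    {γ : Fin k → A} (hγ : γ o = 0) :
    ∃ m g, hx.Acts m g ∧ g.1 *ᵥ Pi.single o 1 = Pi.single o 1 + MulOpposite.op d • γ ∧
      ((hx.col γ * base x o d : Q) : Q ⧸ hx.parabolic) = (m * base x o d : Q) := by
  obtain ⟨m₁, g₁, h₁, hg₁, hc⟩ := hx.exists_acts_pivot_col o (d - 1) γ hγ
  obtain ⟨m, g, h, hg, -⟩ := hx.exists_acts_pivot_col o d γ hγ
  have hgo : g.1 *ᵥ Pi.single o 1 = Pi.single o 1 + MulOpposite.op d • γ := by
    rw [hg]; ext i; simp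
  refine ⟨m, g, h, hgo, ?_⟩
  have e1 : hx.col γ * base x o d = x none (some o) (d - 1) *
      hx.col (Pi.single o 1 + MulOpposite.op d • γ) * m₁ := by
    have h2 := (h₁.col (Pi.single o 1)).eq
    have h3 : γ + g₁.1 *ᵥ Pi.single o 1 = Pi.single o 1 + MulOpposite.op d • γ := by
      rw [hg₁]; ext i; simp only [mul_sub, Pi.add_apply, Pi.smul_apply, Pi.single_eq_same, mul_one,
        MulOpposite.smul_eq_mul_unop, MulOpposite.unop_op]; abel
    rw [base, ← mul_assoc, hc, ← hx.col_single, mul_assoc, mul_assoc, h2, ← mul_assoc (hx.col γ),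
      ← hx.col_add, h3, mul_assoc]
  have e2 : m * base x o d = x none (some o) (d - 1) *
      hx.col (Pi.single o 1 + MulOpposite.op d • γ) * m := by
    have h2 := (h.col (Pi.single o 1)).eq
    rw [hgo] at h2
    have h3 := (h.row (Pi.single o (d - 1))).eq
    have h4 : Pi.single o (d - 1) ᵥ* g.1 = Pi.single o (d - 1) := by
      ext j
      have := Matrix.dotProduct_mulVec (Pi.single o (d - 1)) g.1 (Pi.single j (1 : A))
      rw [hg] at this
      by_cases hj : j = o
      · subst hj
        simpa [hγ] using this.symm
      · simpa [hγ, hj, Ne.symm hj] using this.symm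
    rw [h4] at h3
    rw [base, ← hx.row_single, ← mul_assoc, h3, ← hx.col_single, mul_assoc, h2, mul_assoc]
  rw [e1, e2, QuotientGroup.mk_mul_of_mem _ h₁.mem_parabolic,
    QuotientGroup.mk_mul_of_mem _ h.mem_parabolic]

theorem exists_acts_weyl (hx : IsSteinberg x) {o l : Fin k} (hol : o ≠ l) (u : Aˣ) :
    ∃ g, hx.Acts (weyl x (some o) (some l) u) g ∧
      ∀ v, g.1 *ᵥ v = Function.update (Function.update v o (↑u⁻¹ * v l)) l (-(u * v o)) := by
  refine ⟨_, ((hx.acts_elem hol.symm _).mul (hx.acts_elem hol _)).mul (hx.acts_elem hol.symm _),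
    fun v => ?_⟩
  rw [Units.val_mul, Units.val_mul, ← Matrix.mulVec_mulVec, ← Matrix.mulVec_mulVec,
    elementaryUnit_mulVec, elementaryUnit_mulVec, elementaryUnit_mulVec]
  ext i
  by_cases h : i = o
  · subst h; simp [hol, mul_add]
  · by_cases h' : i = l
    · subst h'; simp [hol, hol.symm, mul_add]
    · simp [h, h']

theorem exists_acts_weyl_mul_inv (hx : IsSteinberg x) {o l : Fin k} (hol : o ≠ l) (u : Aˣ) :
    ∃ g, hx.Acts (weyl x (some o) (some l) 1 * (weyl x (some o) (some l) u)⁻¹) g ∧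
      ∀ v, g.1 *ᵥ v = Function.update (Function.update v o (u * v o)) l (↑u⁻¹ * v l) := by
  obtain ⟨g₁, h₁, hg₁⟩ := hx.exists_acts_weyl hol 1
  obtain ⟨g₂, h₂, hg₂⟩ := hx.exists_acts_weyl hol u
  refine ⟨_, h₁.mul h₂.inv, fun v => ?_⟩
  have e : v = g₂.1 *ᵥ Function.update (Function.update v o (-(↑u⁻¹ * v l))) l (u * v o) := by
    rw [hg₂]
    ext i
    by_cases h : i = o
    · subst h; simp [hol]
    · by_cases h' : i = l
      · subst h'; simp [hol]
      · simp [h, h']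
  conv_lhs => rw [e]
  rw [Units.val_mul, Matrix.mulVec_mulVec, mul_assoc, ← Units.val_mul, inv_mul_cancel,
    Units.val_one, mul_one, hg₁]
  ext i
  by_cases h : i = o
  · subst h; simp [hol]
  · by_cases h' : i = l
    · subst h'; simp [hol]
    · simp [h, h']

/-- The case in which the entry `o` of the new column is a unit. Its part in the place `o` is moved
across by `exists_mul_eq_weyl_mul`, and the rest does not meet the pivot. -/
theorem exists_mk_col_mul_base_of_isUnit (hx : IsSteinberg x) {o l : Fin k} (hol : o ≠ l) (d : A)
    {γ : Fin k → A} (hγ : IsUnit (1 + γ o * d)) :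
    ∃ m g, hx.Acts m g ∧ g.1 *ᵥ Pi.single o 1 = Pi.single o 1 + MulOpposite.op d • γ ∧
      ((hx.col γ * base x o d : Q) : Q ⧸ hx.parabolic) = (m * base x o d : Q) := by
  obtain ⟨u, hu⟩ := hγ
  obtain ⟨g₁, h₁, hg₁⟩ := hx.exists_acts_weyl_mul_inv hol u
  obtain ⟨p, hp, hpe⟩ := hx.exists_mul_eq_weyl_mul (i := some o) (j := some l) (k := none)
    (by simpa using hol) (by simp) (by simp) hu (P := hx.parabolic)
    (fun a => hx.row_single o a ▸ hx.row_mem_parabolic _)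
    (fun a => (hx.acts_elem hol a).mem_parabolic)
    (fun a => (hx.acts_elem hol.symm a).mem_parabolic)
  set h := weyl x (some o) (some l) 1 * (weyl x (some o) (some l) u)⁻¹
  -- the column which `h` carries to `γ` with the entry `o` removed
  set δ : Fin k → A := Function.update (Function.update γ o 0) l (u * γ l) with hδ
  have hδo : δ o = 0 := by simp [hδ, hol]
  obtain ⟨m₂, g₂, h₂, hg₂, he⟩ := hx.exists_mk_col_mul_base_of_eq_zero d hδo
  refine ⟨_, _, h₁.mul h₂, ?_, ?_⟩
  · rw [Units.val_mul, ← Matrix.mulVec_mulVec, hg₂, hg₁]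
    ext i
    by_cases hi : i = o
    · subst hi; simp [hol, hδ, hu]
    · by_cases h' : i = l
      · subst h'; simp [hol.symm, hδ, mul_assoc]
      · simp [hi, h', hδ]
  · have e1 : γ = g₁.1 *ᵥ δ + Pi.single o (γ o) := by
      rw [hg₁]
      ext i
      by_cases hi : i = o
      · subst hi; simp [hol, hδ]
      · by_cases h' : i = l
        · subst h'; simp [hδ, hi]
        · simp [hi, h', hδ]
    have e2 : hx.col γ * base x o d = h * (hx.col δ * base x o d) * p := by
      conv_lhs => rw [e1]
      rw [hx.col_add, hx.col_single, mul_assoc, base, hpe]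
      have := (h₁.col δ).eq
      calc _ = hx.col (g₁.1 *ᵥ δ) * h * (x none (some o) (d - 1) * x (some o) none 1) * p := by
            group
        _ = _ := by rw [← this]; group
    rw [e2, QuotientGroup.mk_mul_of_mem _ hp, mk_mul_congr he, ← mul_assoc]

theorem dotProduct_mulVec_single (g : GL (Fin k) A) (o : Fin k) :
    (Pi.single o 1 ᵥ* g⁻¹.1) ⬝ᵥ (g.1 *ᵥ Pi.single o (1 : A)) = 1 := by
  rw [← Matrix.dotProduct_mulVec, Matrix.mulVec_mulVec, ← Units.val_mul, inv_mul_cancel,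
    Units.val_one, Matrix.one_mulVec]
  simp

theorem dotProduct_eq_add_update (ρ v : Fin k → A) (l : Fin k) :
    ρ ⬝ᵥ v = ρ l * v l + ∑ i, Function.update ρ l 0 i * v i := by
  rw [dotProduct, ← Finset.add_sum_erase _ _ (Finset.mem_univ l),
    ← Finset.add_sum_erase Finset.univ (fun i => Function.update ρ l 0 i * v i)
      (Finset.mem_univ l), Function.update_self, zero_mul, zero_add]
  congr 1
  refine Finset.sum_congr rfl fun i hi => ?_
  rw [Function.update_of_ne (Finset.ne_of_mem_erase hi)]

theorem mk_col_mul_base [Finite A] (hx : IsSteinberg x) (hk : 2 ≤ k) {o : Fin k} (d : A)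
    {γ : Fin k → A} {m' : Q} {g' : GL (Fin k) A} (h' : hx.Acts m' g')
    (hg' : g'.1 *ᵥ Pi.single o 1 = Pi.single o 1 + MulOpposite.op d • γ) :
    ((hx.col γ * base x o d : Q) : Q ⧸ hx.parabolic) = (m' * base x o d : Q) := by
  have hnt : Nontrivial (Fin k) := Fin.nontrivial_iff_two_le.2 hk
  obtain ⟨l, hl⟩ := exists_ne o
  have hdot := dotProduct_mulVec_single g' o
  set ρ := Pi.single o 1 ᵥ* g'⁻¹.1
  rw [dotProduct_eq_add_update ρ _ o, ← one_mul (∑ i, _)] at hdot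
  obtain ⟨t₀, hu⟩ := exists_isUnit_add_mul hdot
  -- a row operation fixing the basis vector `o` makes the entry `o` of the column a unit
  set t : Fin k → A := fun i => t₀ * Function.update ρ o 0 i with ht
  have hto : t o = 0 := by simp [ht]
  obtain ⟨m₁, g₁, h₁, hg₁⟩ := hx.exists_acts_pivot_row o t hto
  have hfix : g₁.1 *ᵥ Pi.single o 1 = Pi.single o 1 := by
    rw [hg₁]; simp [Pi.single_apply, hto]
  have hlin : g₁.1 *ᵥ (Pi.single o 1 + MulOpposite.op d • γ) =
      Pi.single o 1 + MulOpposite.op d • (g₁.1 *ᵥ γ) := by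
    rw [Matrix.mulVec_add, hfix, Matrix.mulVec_smul]
  have hu' : IsUnit (1 + (g₁.1 *ᵥ γ) o * d) := by
    have e : (g₁.1 *ᵥ (g'.1 *ᵥ Pi.single o 1)) o = 1 + (g₁.1 *ᵥ γ) o * d := by
      rw [hg', hlin]; simp
    rw [← e, hg₁]
    convert hu using 1
    simp [ht, Finset.mul_sum, mul_assoc]
  obtain ⟨m₂, g₂, h₂, hg₂, he⟩ := hx.exists_mk_col_mul_base_of_isUnit hl.symm d hu'
  have e1 : ((m₁ * (hx.col γ * base x o d) : Q) : Q ⧸ hx.parabolic) = (m₂ * base x o d : Q) := by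
    rw [← he, ← mul_assoc, (h₁.col γ).eq, mul_assoc]
    exact mk_mul_congr (hx.mk_mul_base_of_fixed h₁ hfix d) _
  have e2 := mk_mul_congr e1 m₁⁻¹
  rw [inv_mul_cancel_left, ← mul_assoc] at e2
  rw [e2]
  refine hx.mk_mul_base_eq (h₁.inv.mul h₂) h' ?_ d
  rw [Units.val_mul, ← Matrix.mulVec_mulVec, hg₂, ← hlin, Matrix.mulVec_mulVec, ← Units.val_mul,
    inv_mul_cancel, Units.val_one, Matrix.one_mulVec, hg']

/-- Left multiplication by a column changes the last column as its matrix does, as long as the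
result is again of the form considered. -/
theorem mk_col_mul_mul_base [Finite A] (hx : IsSteinberg x) (hk : 2 ≤ k) {o : Fin k} (d : A)
    {γ : Fin k → A} {m m' : Q} {g g' : GL (Fin k) A} (h : hx.Acts m g) (h' : hx.Acts m' g')
    (hg' : g'.1 *ᵥ Pi.single o 1 = g.1 *ᵥ Pi.single o 1 + MulOpposite.op d • γ) :
    ((hx.col γ * (m * base x o d) : Q) : Q ⧸ hx.parabolic) = (m' * base x o d : Q) := by
  have hcancel : ∀ v, g⁻¹.1 *ᵥ (g.1 *ᵥ v) = v := fun v => by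
    rw [Matrix.mulVec_mulVec, ← Units.val_mul, inv_mul_cancel, Units.val_one, Matrix.one_mulVec]
  have e := hx.mk_col_mul_base hk (o := o) d (γ := g⁻¹.1 *ᵥ γ) (h.inv.mul h') (by
    rw [Units.val_mul, ← Matrix.mulVec_mulVec, hg', Matrix.mulVec_add, hcancel,
      Matrix.mulVec_smul])
  have e2 := mk_mul_congr e m
  have e3 : m * (hx.col (g⁻¹.1 *ᵥ γ) * base x o d) = hx.col γ * (m * base x o d) := by
    rw [← mul_assoc, ← mul_assoc, h.mul_col_inv]
  rwa [e3, mul_assoc m⁻¹, mul_inv_cancel_left] at e2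

end Cosets

end IsSteinberg

/-! ### Finiteness of Steinberg groups over finite rings -/

open scoped commutatorElement

theorem exists_ne_ne_of_three_le {n : ℕ} (hn : 3 ≤ n) (i j : Fin n) : ∃ l, i ≠ l ∧ l ≠ j := by
  obtain ⟨l, hl⟩ := Finset.exists_mem_notMem_of_card_lt_card
    (s := {i, j}) (t := (Finset.univ : Finset (Fin n)))
    (lt_of_le_of_lt Finset.card_le_two (by simpa using by omega))
  simp only [Finset.mem_insert, Finset.mem_singleton, not_or] at hl
  exact ⟨l, Ne.symm hl.2.1, hl.2.2⟩

theorem finite_commutatorSet_of_finiteIndex_center (Q : Type*) [Group Q]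
    [(Subgroup.center Q).FiniteIndex] : Finite (commutatorSet Q) := by
  let F : (Q ⧸ Subgroup.center Q) × (Q ⧸ Subgroup.center Q) → Q := fun p => ⁅p.1.out, p.2.out⁆
  refine ((Set.finite_range F).subset ?_).to_subtype
  rintro _ ⟨a, b, rfl⟩
  refine ⟨(a, b), ?_⟩
  obtain ⟨⟨z, hz⟩, ha⟩ := QuotientGroup.mk_out_eq_mul (Subgroup.center Q) a
  obtain ⟨⟨w, hw⟩, hb⟩ := QuotientGroup.mk_out_eq_mul (Subgroup.center Q) b
  simp only [F, ha, hb, commutatorElement_def]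
  rw [Subgroup.mem_center_iff] at hz hw
  calc a * z * (b * w) * (a * z)⁻¹ * (b * w)⁻¹
      = a * (z * (b * w) * z⁻¹) * a⁻¹ * (b * w)⁻¹ := by group
    _ = a * (b * w) * a⁻¹ * (b * w)⁻¹ := by rw [← hz (b * w), mul_inv_cancel_right]
    _ = a * b * (w * a⁻¹ * w⁻¹) * b⁻¹ := by group
    _ = a * b * a⁻¹ * b⁻¹ := by rw [← hw a⁻¹, mul_inv_cancel_right]

namespace IsSteinberg

section Parabolic

variable {A Q : Type*} [Ring A] [Group Q] {k : ℕ} {x : Option (Fin k) → Option (Fin k) → A → Q}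

/-- The cosets represented by `hx.col γ * (m * base x o d)` are permuted by the elements
`x none (some j) a`: stable range one lets `γ` be replaced by a column with a single nonzero entry,
in a place different from `j`. -/
theorem exists_mk_row_mul_eq [Finite A] (hx : IsSteinberg x) (hk : 2 ≤ k) (o j : Fin k) (a : A)
    (γ : Fin k → A) {m : Q} {g : GL (Fin k) A} (h : hx.Acts m g) (d : A) :
    ∃ γ' m' g' d', hx.Acts m' g' ∧
      ((x none (some j) a * (hx.col γ * (m * base x o d)) : Q) : Q ⧸ hx.parabolic) =
        (hx.col γ' * (m' * base x o d') : Q) := by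
  have hnt : Nontrivial (Fin k) := Fin.nontrivial_iff_two_le.2 hk
  obtain ⟨l, hl⟩ := exists_ne j
  set ρ := Pi.single o 1 ᵥ* g⁻¹.1 with hρ
  set v : Fin k → A := g.1 *ᵥ Pi.single o 1 + MulOpposite.op d • γ with hv
  have hsm : ρ ⬝ᵥ (MulOpposite.op d • γ) = (ρ ⬝ᵥ γ) * d := by
    simp [dotProduct, Finset.sum_mul, mul_assoc]
  set s := -(ρ ⬝ᵥ γ) with hs
  have hdot : ρ l * v l + 1 * (∑ i, Function.update ρ l 0 i * v i + s * d) = 1 := by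
    rw [one_mul, ← add_assoc, ← dotProduct_eq_add_update, hv, dotProduct_add,
      dotProduct_mulVec_single g o, hsm, hs]
    noncomm_ring
  obtain ⟨t₀, hu⟩ := exists_isUnit_add_mul hdot
  have hu' : IsUnit ((v + Pi.single l (t₀ * s * d) : Fin k → A) l + ∑ i,
      (t₀ * Function.update ρ l 0 i) * (v + Pi.single l (t₀ * s * d) : Fin k → A) i) := by
    convert hu using 1
    have e : ∀ i, (t₀ * Function.update ρ l 0 i) * (v + Pi.single l (t₀ * s * d) : Fin k → A) i =
        t₀ * (Function.update ρ l 0 i * v i) := fun i => by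
      by_cases hi : i = l
      · subst hi; simp
      · simp [hi, mul_assoc]
    simp only [e]
    rw [← Finset.mul_sum, Pi.add_apply, Pi.single_eq_same, mul_add, mul_assoc]
    abel
  obtain ⟨m', g', h', hg'⟩ := hx.exists_acts_mulVec_eq hk o l _ _ (by simp) hu'
  have e1 := hx.mk_col_mul_mul_base hk (o := o) d (γ := γ + Pi.single l (t₀ * s)) h h' (by
    rw [hg', hv, smul_add, add_assoc]
    congr 2
    ext i
    by_cases hi : i = l
    · subst hi; simp
    · simp [hi])
  have e2 := mk_mul_congr e1 (hx.col (Pi.single l (-(t₀ * s))))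
  rw [← mul_assoc, ← hx.col_add, add_left_comm, ← Pi.single_add, neg_add_cancel,
    Pi.single_zero, add_zero] at e2
  set b := -(t₀ * s)
  have hlj : some l ≠ some j := by simpa using hl
  have e3 : x none (some j) a * hx.col (Pi.single l b) =
      hx.col (Pi.single l b) * (x (some l) (some j) (b * a))⁻¹ * hx.row (Pi.single j a) := by
    have h1 := hx.mul_comm' (i := some l) (j := none) (k := some j) (by simp) (by simp) hlj b a
    have h2 : Commute (x (some l) none b) (x (some l) (some j) (b * a)) :=
      hx.commute (by simp) hlj (by simp) hlj _ _
    rw [hx.col_single, hx.row_single, h2.inv_right.eq, mul_assoc, h1, inv_mul_cancel_left]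
  refine ⟨Pi.single l b, (x (some l) (some j) (b * a))⁻¹ * m', _, d + (Pi.single j a ᵥ* g'.1) o,
    (hx.acts_elem hl _).inv.mul h', ?_⟩
  rw [mk_mul_congr e2, ← mul_assoc, e3, mul_assoc, mul_assoc (hx.col _),
    mk_mul_congr (mk_mul_congr (hx.mk_row_mul_base h' o (Pi.single j a) d) _) _]
  simp only [mul_assoc]

/-- Every coset of the parabolic subgroup has a representative `hx.col γ * (m * base x o d)`. -/
theorem exists_mk_eq [Finite A] (hx : IsSteinberg x) (hk : 2 ≤ k) (o : Fin k)
    (hgen : Subgroup.closure {q | ∃ i j a, i ≠ j ∧ q = x i j a} = ⊤) (q : Q) :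
    ∃ γ m g d, hx.Acts m g ∧ (q : Q ⧸ hx.parabolic) = (hx.col γ * (m * base x o d) : Q) := by
  have step : ∀ i j a, i ≠ j → ∀ y : Q,
      (∃ γ m g d, hx.Acts m g ∧ (y : Q ⧸ hx.parabolic) = (hx.col γ * (m * base x o d) : Q)) →
      ∃ γ m g d, hx.Acts m g ∧
        ((x i j a * y : Q) : Q ⧸ hx.parabolic) = (hx.col γ * (m * base x o d) : Q) := by
    rintro i j a hij y ⟨γ, m, g, d, h, hy⟩
    rw [mk_mul_congr hy]
    match i, j with
    | none, none => exact absurd rfl hij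
    | none, some j => exact hx.exists_mk_row_mul_eq hk o j a γ h d
    | some i, none =>
      refine ⟨Pi.single i a + γ, m, g, d, h, ?_⟩
      rw [hx.col_add, hx.col_single, mul_assoc]
    | some i, some j =>
      have hij' : i ≠ j := fun e => hij (congrArg some e)
      have ha := hx.acts_elem hij' a
      refine ⟨(elementaryUnit i j hij' a).1 *ᵥ γ, _, _, d, ha.mul h, ?_⟩
      rw [← mul_assoc, (ha.col γ).eq, mul_assoc, mul_assoc (x _ _ _)]
  have hq : q ∈ Subgroup.closure {q | ∃ i j a, i ≠ j ∧ q = x i j a} := hgen ▸ Subgroup.mem_top q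
  induction hq using Subgroup.closure_induction_left with
  | one =>
    refine ⟨-Pi.single o 1, 1, 1, 1, Acts.one, ?_⟩
    rw [hx.col_neg, hx.col_single, base, sub_self, hx.map_zero (by simp), one_mul, one_mul,
      inv_mul_cancel]
  | mul_left y hy z _ ih =>
    obtain ⟨i, j, a, hij, rfl⟩ := hy
    exact step i j a hij z ih
  | inv_mul_cancel y hy z _ ih =>
    obtain ⟨i, j, a, hij, rfl⟩ := hy
    rw [← hx.map_neg hij]
    exact step i j _ hij z ih

theorem finiteIndex_parabolic [Finite A] (hx : IsSteinberg x) (hk : 2 ≤ k)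
    (hgen : Subgroup.closure {q | ∃ i j a, i ≠ j ∧ q = x i j a} = ⊤) :
    hx.parabolic.FiniteIndex := by
  let o : Fin k := ⟨0, by omega⟩
  let F : (Fin k → A) × (Fin k → A) × (Fin k → A) → Q ⧸ hx.parabolic :=
    fun p => (hx.col p.1 * (hx.row p.2.1 * hx.col p.2.2) : Q)
  have hF : Function.Surjective F := by
    intro z
    obtain ⟨q, rfl⟩ := QuotientGroup.mk_surjective z
    obtain ⟨γ, m, g, d, h, hq⟩ := hx.exists_mk_eq hk o hgen q
    refine ⟨(γ, Pi.single o (d - 1) ᵥ* g⁻¹.1, g.1 *ᵥ Pi.single o 1), ?_⟩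
    have e : hx.col γ * (m * base x o d) = hx.col γ * (hx.row (Pi.single o (d - 1) ᵥ* g⁻¹.1) *
        hx.col (g.1 *ᵥ Pi.single o 1)) * m := by
      rw [base, ← hx.row_single, ← hx.col_single, ← mul_assoc m, h.mul_row, mul_assoc (hx.row _) m,
        (h.col _).eq]
      group
    rw [hq, e, QuotientGroup.mk_mul_of_mem _ h.mem_parabolic]
  have : Finite (Q ⧸ hx.parabolic) := Finite.of_surjective F hF
  exact Subgroup.finiteIndex_of_finite_quotient

/-- The parabolic subgroup acts on the finite group of rows by conjugation, with a kernel of finite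
index. -/
theorem finiteIndex_centralizer_row [Finite A] (hx : IsSteinberg x) (hk : 2 ≤ k)
    (hgen : Subgroup.closure {q | ∃ i j a, i ≠ j ∧ q = x i j a} = ⊤) (j : Fin k) (a : A) :
    (Subgroup.centralizer {x none (some j) a}).FiniteIndex := by
  have hP := hx.finiteIndex_parabolic hk hgen
  have hfin : Finite hx.rowGroup := (Set.finite_range hx.row).to_subtype
  have hker : ((Subgroup.centralizer (hx.rowGroup : Set Q)).subgroupOf
      (Subgroup.normalizer (hx.rowGroup : Set Q))).FiniteIndex := by
    rw [← Subgroup.normalizerMonoidHom_ker]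
    infer_instance
  have hC : (Subgroup.centralizer (hx.rowGroup : Set Q)).FiniteIndex := by
    refine ⟨?_⟩
    rw [← Subgroup.relIndex_mul_index (Subgroup.centralizer_le_normalizer _)]
    exact mul_ne_zero hker.index_ne_zero hP.index_ne_zero
  refine Subgroup.finiteIndex_of_le (H := Subgroup.centralizer (hx.rowGroup : Set Q)) ?_
  apply Subgroup.centralizer_le
  rintro _ rfl
  exact hx.row_single j a ▸ hx.row_mem_rowGroup _

end Parabolic

section Finite

variable {A Q : Type*} [Ring A] [Group Q] {n : ℕ} {x : Fin n → Fin n → A → Q}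

theorem finiteIndex_centralizer [Finite A] (hx : IsSteinberg x) (hn : 3 ≤ n)
    (hgen : Subgroup.closure {q | ∃ i j a, i ≠ j ∧ q = x i j a} = ⊤) {i j : Fin n} (hij : i ≠ j)
    (a : A) : (Subgroup.centralizer {x i j a}).FiniteIndex := by
  obtain ⟨k, rfl⟩ : ∃ k, n = k + 1 := ⟨n - 1, by omega⟩
  set σ := (finSuccEquiv' i).symm with hσ
  have hσi : σ none = i := finSuccEquiv'_symm_none i
  have hx' := hx.comp_injective σ.injective
  obtain ⟨l, hl⟩ : ∃ l, σ (some l) = j := by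
    obtain ⟨l, hl⟩ := σ.surjective j
    cases l with
    | none => exact absurd (hσi.symm.trans hl) hij
    | some l => exact ⟨l, hl⟩
  have h := hx'.finiteIndex_centralizer_row (by omega) (by
    rw [eq_top_iff, ← hgen, Subgroup.closure_le]
    rintro _ ⟨i, j, a, hij, rfl⟩
    refine Subgroup.subset_closure ⟨σ.symm i, σ.symm j, a, σ.symm.injective.ne hij, by simp⟩) l a
  rwa [hσi, hl] at h

/-- A group generated by elements satisfying the Steinberg relations of size at least `3` over a
finite ring is finite: it is perfect and its center has finite index, so Schur's theorem
applies. -/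
theorem finite [Finite A] (hx : IsSteinberg x) (hn : 3 ≤ n)
    (hgen : Subgroup.closure {q | ∃ i j a, i ≠ j ∧ q = x i j a} = ⊤) : Finite Q := by
  have hcenter : (Subgroup.center Q).FiniteIndex := by
    have hfin : Set.Finite {q | ∃ i j a, i ≠ j ∧ q = x i j a} := by
      refine (Set.finite_range fun p : Fin n × Fin n × A => x p.1 p.2.1 p.2.2).subset ?_
      rintro _ ⟨i, j, a, -, rfl⟩
      exact ⟨(i, j, a), rfl⟩
    have := hfin.to_subtype
    rw [Subgroup.center_eq_infi' hgen]
    refine Subgroup.finiteIndex_iInf ?_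
    rintro ⟨_, i, j, a, hij, rfl⟩
    exact hx.finiteIndex_centralizer hn hgen hij a
  have hcomm := finite_commutatorSet_of_finiteIndex_center Q
  have htop : commutator Q = ⊤ := by
    rw [eq_top_iff, ← hgen, Subgroup.closure_le]
    rintro _ ⟨i, j, a, hij, rfl⟩
    obtain ⟨l, hil, hlj⟩ := exists_ne_ne_of_three_le hn i j
    have h := hx.mul_comm' hil hlj hij a 1
    rw [mul_one] at h
    have e : x i j a = ⁅x i l a, x l j 1⁆ := by
      rw [commutatorElement_def, h]; group
    rw [e]
    exact Subgroup.commutator_mem_commutator (Subgroup.mem_top _) (Subgroup.mem_top _)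
  have : Finite (commutator Q) := inferInstance
  rw [htop] at this
  exact Finite.of_equiv _ Subgroup.topEquiv.toEquiv

end Finite

end IsSteinberg

/-! ### Length functions and Heisenberg relations -/

/-- A length function vanishes on central commutators: `z ^ k * y` is conjugate to `y` for all
`k`. -/
theorem IsLengthFunction.eq_zero_of_mul_eq {G : Type*} [Group G] {l : G → ℝ}
    (hl : IsLengthFunction l) {x y z : G} (h : x * y = z * (y * x)) (hzx : Commute z x)
    (hzy : Commute z y) : l z = 0 := by
  have hconj : ∀ k : ℕ, x ^ k * y * (x ^ k)⁻¹ = z ^ k * y := by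
    intro k
    induction k with
    | zero => simp
    | succ k ih =>
      have e : x * y * x⁻¹ = z * y := by rw [h]; group
      calc x ^ (k + 1) * y * (x ^ (k + 1))⁻¹ = x * (x ^ k * y * (x ^ k)⁻¹) * x⁻¹ := by
            rw [pow_succ']; group
        _ = z ^ k * (x * y * x⁻¹) := by
            rw [ih, ← mul_assoc x, ← (hzx.pow_left k).eq]; group
        _ = z ^ (k + 1) * y := by rw [e, ← mul_assoc, pow_succ]
  have hbound : ∀ k : ℕ, (k : ℝ) * l z ≤ 2 * l y := by
    intro k
    have h1 := hl.map_mul_le (z ^ k * y) y⁻¹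
      (((hzy.pow_left k).mul_left (Commute.refl y)).inv_right)
    have h2 := hl.map_zpow z k
    have h3 := hl.map_zpow y (-1)
    have h4 := hl.map_conj (x ^ k) y
    rw [hconj] at h4
    rw [mul_inv_cancel_right, h4] at h1
    rw [zpow_natCast, Int.cast_natCast, Nat.abs_cast] at h2
    rw [_root_.zpow_neg_one] at h3
    norm_num at h3
    linarith
  by_contra hne
  have hpos : 0 < l z := lt_of_le_of_ne (hl.nonneg z) (Ne.symm hne)
  obtain ⟨k, hk⟩ := exists_nat_gt (2 * l y / l z)
  rw [div_lt_iff₀ hpos] at hk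
  exact absurd (hbound k) (not_le_of_gt hk)

/-- A central commutator has finite order in any group whose finitely generated subgroups have
purely positive length functions. -/
theorem isOfFinOrder_map_of_mul_eq {T B : Type*} [Group T] [Group B] (ψ : T →* B)
    (hB : ∀ K : Subgroup B, K.FG → HasPurelyPositiveLength K) {x y z : T}
    (h : x * y = z * (y * x)) (hzx : Commute z x) (hzy : Commute z y) : IsOfFinOrder (ψ z) := by
  classical
  let K := Subgroup.closure {ψ x, ψ y}
  have hx : ψ x ∈ K := Subgroup.subset_closure (by simp)
  have hy : ψ y ∈ K := Subgroup.subset_closure (by simp)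
  have hz : ψ z ∈ K := by
    have : z = x * y * (y * x)⁻¹ := by rw [h, mul_inv_cancel_right]
    rw [this, map_mul, map_mul, map_inv, map_mul]
    exact mul_mem (mul_mem hx hy) (inv_mem (mul_mem hy hx))
  obtain ⟨l, hl, hpos⟩ := hB K ⟨{ψ x, ψ y}, by simp [K]⟩
  have h0 : l ⟨ψ z, hz⟩ = 0 :=
    hl.eq_zero_of_mul_eq (x := ⟨ψ x, hx⟩) (y := ⟨ψ y, hy⟩)
      (Subtype.ext (by simpa using congrArg ψ h)) (Subtype.ext (hzx.map ψ).eq)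
      (Subtype.ext (hzy.map ψ).eq)
  have hfin : IsOfFinOrder (⟨ψ z, hz⟩ : K) := by
    by_contra hinf
    exact (hpos _ hinf).ne' h0
  exact K.subtype.isOfFinOrder hfin

/-! ### Elementary matrices in the kernel -/

theorem exists_pos_forall_pow_mem {G : Type*} [Group G] (S : Subgroup G) [S.FiniteIndex] :
    ∃ m : ℕ, 0 < m ∧ ∀ g : G, g ^ m ∈ S :=
  ⟨S.normalCore.index, Nat.pos_of_ne_zero Subgroup.FiniteIndex.index_ne_zero,
    fun g => S.normalCore_le (Subgroup.pow_index_mem _ g)⟩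

namespace IsSteinberg

variable {R E : Type*} [Ring R] [Group E] {n : ℕ} {x : Fin n → Fin n → R → E}

theorem map_natCast_mul (hx : IsSteinberg x) {i j : Fin n} (hij : i ≠ j) (m : ℕ) (r : R) :
    x i j (m * r) = x i j r ^ m := by
  induction m with
  | zero => simp [hx.map_zero hij]
  | succ m ih => rw [Nat.cast_succ, add_mul, one_mul, hx.map_add hij, ih, pow_succ]

theorem conj (hx : IsSteinberg x) (g : E) : IsSteinberg fun i j a => g * x i j a * g⁻¹ where
  map_add hij a b := by rw [hx.map_add hij]; group
  commute hij hkl hjk hil a b := by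
    have := (hx.commute hij hkl hjk hil a b).map (MulAut.conj g)
    simpa using this
  mul_comm' hij hjk hik a b := by
    have := congrArg (MulAut.conj g) (hx.mul_comm' hij hjk hik a b)
    simpa [mul_assoc] using this

/-- A homomorphism to a poly-positive group kills some integral elementary matrices: if they map
into one term of the subnormal series, then their powers map into the next term. -/
theorem exists_map_eq_one_of_isPolyPositive (hx : IsSteinberg x) (hn : 3 ≤ n) {T H : Type*}
    [Group T] [Group H] (hH : IsPolyPositive H) {ι : T →* E} (hι : Function.Injective ι)
    (φ : T →* H) (hT : ∃ M : ℕ, 0 < M ∧ ∀ i j, i ≠ j → ∃ s, ι s = x i j M) :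
    ∃ M : ℕ, 0 < M ∧ ∀ i j, i ≠ j → ∃ s, ι s = x i j M ∧ φ s = 1 := by
  obtain ⟨k, L, h0, hk, hL⟩ := hH
  suffices hmain : ∀ c ≤ k, ∃ M : ℕ, 0 < M ∧ ∀ i j, i ≠ j → ∃ s, ι s = x i j M ∧ φ s ∈ L c by
    simpa [hk] using hmain k le_rfl
  intro c
  induction c with
  | zero => intro _; simpa [h0] using hT
  | succ c ih =>
    intro hc
    obtain ⟨M, hM, hs⟩ := ih (by omega)
    obtain ⟨-, hnormal, hpos⟩ := hL c (by omega)
    choose! s hsx hsL using hs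
    have step : ∀ i j, i ≠ j → ∃ N : ℕ, 0 < N ∧ ∃ t, ι t = x i j (M * M) ∧ φ t ^ N ∈ L (c + 1) := by
      intro i j hij
      obtain ⟨l, hil, hlj⟩ := exists_ne_ne_of_three_le hn i j
      let T' := (L c).comap φ
      let a : T' := ⟨s i l, hsL i l hil⟩
      let b : T' := ⟨s l j, hsL l j hlj⟩
      let z : T' := a * b * (b * a)⁻¹
      have hz : ι z.1 = x i j (M * M) := by
        change ι (s i l * s l j * (s l j * s i l)⁻¹) = _
        rw [map_mul, map_inv, map_mul, map_mul, hsx i l hil, hsx l j hlj,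
          hx.mul_comm' hil hlj hij, mul_inv_cancel_right]
      have hza : Commute z a := Subtype.ext (hι (by
        change ι (z.1 * s i l) = ι (s i l * z.1)
        rw [map_mul, map_mul, hz, hsx i l hil]
        exact hx.commute hij hil hij.symm hil _ _))
      have hzb : Commute z b := Subtype.ext (hι (by
        change ι (z.1 * s l j) = ι (s l j * z.1)
        rw [map_mul, map_mul, hz, hsx l j hlj]
        exact hx.commute hij hlj hlj.symm hij _ _))
      have hfin := isOfFinOrder_map_of_mul_eq
        ((QuotientGroup.mk' ((L (c + 1)).subgroupOf (L c))).comp (φ.subgroupComap (L c))) hpos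
        (x := a) (y := b) (z := z) (inv_mul_cancel_right (a * b) (b * a)).symm hza hzb
      obtain ⟨N, hN, hN1⟩ := hfin.exists_pow_eq_one
      refine ⟨N, hN, z.1, hz, ?_⟩
      rw [← map_pow, MonoidHom.comp_apply, QuotientGroup.mk'_apply, QuotientGroup.eq_one_iff,
        Subgroup.mem_subgroupOf, map_pow] at hN1
      exact hN1
    choose! N hN t htx htL using step
    set P := ∏ p ∈ (Finset.univ : Finset (Fin n × Fin n)).filter (fun p => p.1 ≠ p.2), N p.1 p.2
      with hP
    refine ⟨P * (M * M), Nat.mul_pos (Finset.prod_pos fun p hp => hN _ _ (by simpa using hp))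
      (Nat.mul_pos hM hM), fun i j hij => ⟨t i j ^ P, ?_, ?_⟩⟩
    · rw [map_pow, htx i j hij, ← hx.map_natCast_mul hij]
      push_cast
      rfl
    · obtain ⟨q, hq⟩ : N i j ∣ P :=
        Finset.dvd_prod_of_mem (fun p : Fin n × Fin n => N p.1 p.2) (a := (i, j)) (by simpa using hij)
      rw [hq, map_pow, pow_mul]
      exact pow_mem (htL i j hij) q

/-- Commutators with elements of `S` spread the elementary matrices in the kernel of `f` over a
nonzero ideal. -/
theorem exists_map_eq_one (hx : IsSteinberg x) (hn : 3 ≤ n) {G : Type*} [Group G]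
    (hG : IsVirtuallyPolyPositive G) (S : Subgroup E) [S.FiniteIndex] (f : S →* G) :
    ∃ M : ℕ, 0 < M ∧ ∀ i j, i ≠ j → ∀ r : R, x i j (M * r) ∈ f.ker.map S.subtype := by
  obtain ⟨H, hH, hpoly⟩ := hG
  have hcomap : (H.comap f).FiniteIndex :=
    ⟨by rw [Subgroup.index_comap]; exact Subgroup.FiniteIndex.index_ne_zero⟩
  have hS' : ((H.comap f).map S.subtype).FiniteIndex := by
    refine ⟨?_⟩
    rw [Subgroup.index_map_subtype]
    exact mul_ne_zero Subgroup.FiniteIndex.index_ne_zero Subgroup.FiniteIndex.index_ne_zero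
  obtain ⟨m₀, hm₀, hpow₀⟩ := exists_pos_forall_pow_mem ((H.comap f).map S.subtype)
  obtain ⟨M, hM, hker⟩ := hx.exists_map_eq_one_of_isPolyPositive hn hpoly
    (ι := S.subtype.comp (H.comap f).subtype)
    (S.subtype_injective.comp (H.comap f).subtype_injective) (f.subgroupComap H)
    ⟨m₀, hm₀, fun i j hij => by
      obtain ⟨s, hs, hsx⟩ := hpow₀ (x i j 1)
      refine ⟨⟨s, hs⟩, ?_⟩
      rw [← hx.map_natCast_mul hij, mul_one] at hsx
      exact hsx⟩
  obtain ⟨m, hm, hpow⟩ := exists_pos_forall_pow_mem S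
  refine ⟨m * M, Nat.mul_pos hm hM, fun i j hij r => ?_⟩
  obtain ⟨l, hil, hlj⟩ := exists_ne_ne_of_three_le hn i j
  obtain ⟨s, hsx, hs1⟩ := hker l j hlj
  have hfs : f s.1 = 1 := congrArg Subtype.val hs1
  let a : S := ⟨x i l (m * r), by rw [hx.map_natCast_mul hil]; exact hpow _⟩
  refine ⟨a * s.1 * (s.1 * a)⁻¹, ?_, ?_⟩
  · simp [MonoidHom.mem_ker, hfs]
  · have hsx' : (s.1 : E) = x l j M := hsx
    have hcast : ((m * M : ℕ) : R) * r = m * r * M := by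
      rw [Nat.cast_mul, mul_assoc, (Nat.cast_commute M r).eq, mul_assoc]
    change x i l (m * r) * (s.1 : E) * ((s.1 : E) * x i l (m * r))⁻¹ = _
    rw [hsx', hx.mul_comm' hil hlj hij, mul_inv_cancel_right, hcast]

/-- The ideal of `exists_map_eq_one` can be chosen to work for the normal core of the kernel: only finitely many
conjugates of the kernel occur, and the conjugates of the elementary matrices satisfy the Steinberg
relations, too. -/
theorem exists_mem_normalCore (hx : IsSteinberg x) (hn : 3 ≤ n) {G : Type*} [Group G]
    (hG : IsVirtuallyPolyPositive G) (S : Subgroup E) [S.FiniteIndex] (f : S →* G) :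
    ∃ M : ℕ, 0 < M ∧ ∀ i j, i ≠ j → ∀ r : R,
      x i j (M * r) ∈ (f.ker.map S.subtype).normalCore := by
  have hg : ∀ g : E, ∃ M : ℕ, 0 < M ∧ ∀ i j, i ≠ j → ∀ r : R,
      g * x i j (M * r) * g⁻¹ ∈ f.ker.map S.subtype :=
    fun g => (hx.conj g).exists_map_eq_one hn hG S f
  choose M hM hMg using hg
  have : Fintype (E ⧸ S) := Fintype.ofFinite _
  refine ⟨∏ q : E ⧸ S, M q.out⁻¹, Finset.prod_pos fun q _ => hM _, fun i j hij r g => ?_⟩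
  obtain ⟨s, hs⟩ := QuotientGroup.mk_out_eq_mul S g⁻¹
  set q : E := (QuotientGroup.mk g⁻¹ : E ⧸ S).out
  obtain ⟨c, hc⟩ : M q⁻¹ ∣ ∏ q : E ⧸ S, M q.out⁻¹ :=
    Finset.dvd_prod_of_mem (fun q : E ⧸ S => M q.out⁻¹) (Finset.mem_univ (QuotientGroup.mk g⁻¹))
  obtain ⟨t, ht, htx⟩ := hMg q⁻¹ i j hij (c * r)
  have hgq : g = s * q⁻¹ := by rw [hs]; group
  refine ⟨s * t * s⁻¹, f.normal_ker.conj_mem t ht s, ?_⟩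
  rw [hc, Nat.cast_mul, mul_assoc (M q⁻¹ : R), map_mul, map_mul, htx, hgq]
  simp only [Subgroup.subtype_apply, InvMemClass.coe_inv, _root_.mul_inv_rev]
  group

end IsSteinberg

/-! ### The elementary group -/

section ElementaryGroup

variable {R : Type v} [Ring R] {n : ℕ}

/-- The elementary matrix with entry `r` in the place `(i, j)` as an element of the elementary
group; it is set to `1` for `i = j`. -/
def elementaryElem (i j : Fin n) (r : R) : elementaryGroup n R :=
  if hij : i ≠ j then ⟨elementaryUnit i j hij r, Subgroup.subset_closure ⟨i, j, hij, r, rfl⟩⟩ else 1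

theorem coe_elementaryElem {i j : Fin n} (hij : i ≠ j) (r : R) :
    ((elementaryElem i j r : elementaryGroup n R) : GL (Fin n) R).1 =
      1 + Matrix.single i j r := by
  rw [elementaryElem, dif_pos hij]; rfl

theorem isSteinberg_elementaryElem :
    IsSteinberg (elementaryElem : Fin n → Fin n → R → elementaryGroup n R) where
  map_add {i j} hij a b := by
    refine Subtype.ext (Units.ext ?_)
    rw [Subgroup.coe_mul, Units.val_mul, coe_elementaryElem hij, coe_elementaryElem hij,
      coe_elementaryElem hij, mul_add, add_mul, add_mul,
      Matrix.single_mul_single_of_ne _ _ _ _ hij.symm, Matrix.single_add]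
    noncomm_ring
  commute {i j k l} hij hkl hjk hil a b := by
    refine Subtype.ext (Units.ext ?_)
    rw [Subgroup.coe_mul, Subgroup.coe_mul, Units.val_mul, Units.val_mul, coe_elementaryElem hij,
      coe_elementaryElem hkl, mul_add, mul_add, add_mul, add_mul, add_mul, add_mul,
      Matrix.single_mul_single_of_ne _ _ _ _ hjk, Matrix.single_mul_single_of_ne _ _ _ _ hil.symm]
    noncomm_ring
  mul_comm' {i j k} hij hjk hik a b := by
    refine Subtype.ext (Units.ext ?_)
    simp only [Subgroup.coe_mul, Units.val_mul, coe_elementaryElem hij, coe_elementaryElem hjk,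
      coe_elementaryElem hik, mul_add, add_mul, Matrix.single_mul_single_of_ne _ _ _ _ hik.symm,
      Matrix.single_mul_single_of_ne _ _ _ _ hjk.symm,
      Matrix.single_mul_single_same, mul_one, one_mul, mul_zero]
    abel

theorem closure_elementaryElem :
    Subgroup.closure {q | ∃ (i j : Fin n) (a : R), i ≠ j ∧ q = elementaryElem i j a} = ⊤ := by
  refine eq_top_iff.2 ((Subgroup.closure_closure_coe_preimage (k := {g | ∃ (i j : Fin n)
    (hij : i ≠ j) (r : R), g = elementaryUnit i j hij r})).ge.trans ((Subgroup.closure_le _).2 ?_))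
  rintro ⟨_, _⟩ ⟨i, j, hij, r, rfl⟩
  refine Subgroup.subset_closure ⟨i, j, r, hij, Subtype.ext ?_⟩
  rw [elementaryElem, dif_pos hij]

/-- The two-sided ideal of the elements `m * r`. -/
def natMulIdeal (R : Type v) [Ring R] (m : ℕ) : TwoSidedIdeal R :=
  TwoSidedIdeal.mk' (Set.range fun r : R => m * r) ⟨0, mul_zero _⟩
    (by rintro _ _ ⟨r, rfl⟩ ⟨s, rfl⟩; exact ⟨r + s, mul_add _ _ _⟩)
    (by rintro _ ⟨r, rfl⟩; exact ⟨-r, mul_neg _ _⟩)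
    (by
      rintro s _ ⟨r, rfl⟩
      exact ⟨s * r, by simp only [← mul_assoc, (Nat.cast_commute m s).eq]⟩)
    (by rintro _ s ⟨r, rfl⟩; exact ⟨r * s, (mul_assoc _ _ _).symm⟩)

theorem mem_natMulIdeal {m : ℕ} {a : R} : a ∈ natMulIdeal R m ↔ ∃ r, m * r = a :=
  TwoSidedIdeal.mem_mk' _ _ _ _ _ _ _

/-- A quotient of the elementary group in which the elementary matrices with entries in an ideal of
finite index vanish satisfies the Steinberg relations over a finite ring. -/
theorem finite_quotient_of_mem (hn : 3 ≤ n) (I : TwoSidedIdeal R)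
    (hI : I.asIdeal.toAddSubgroup.FiniteIndex) (N : Subgroup (elementaryGroup n R)) [N.Normal]
    (hN : ∀ i j, i ≠ j → ∀ r ∈ I, elementaryElem i j r ∈ N) :
    Finite (elementaryGroup n R ⧸ N) := by
  have hfin : Finite (R ⧸ I.asIdeal) := by
    have : Finite (R ⧸ I.asIdeal.toAddSubgroup) := inferInstance
    exact this
  have hE := isSteinberg_elementaryElem (R := R) (n := n)
  let x : Fin n → Fin n → R ⧸ I.asIdeal → elementaryGroup n R ⧸ N :=
    fun i j a => (elementaryElem i j a.out : elementaryGroup n R)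
  have hmk : ∀ i j, i ≠ j → ∀ r : R,
      x i j (Ideal.Quotient.mk I.asIdeal r) = (elementaryElem i j r : elementaryGroup n R) := by
    intro i j hij r
    have hr : -(Ideal.Quotient.mk I.asIdeal r).out + r ∈ I := by
      rw [← TwoSidedIdeal.mem_asIdeal, ← Ideal.Quotient.eq_zero_iff_mem, map_add, map_neg,
        neg_add_eq_zero]
      exact Quotient.out_eq _
    refine QuotientGroup.eq.2 ?_
    rw [← hE.map_neg hij, ← hE.map_add hij]
    exact hN i j hij _ hr
  have hx : IsSteinberg x := by
    refine ⟨fun hij a b => ?_, fun hij hkl hjk hil a b => ?_, fun hij hjk hik a b => ?_⟩ <;>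
    obtain ⟨a, rfl⟩ := Ideal.Quotient.mk_surjective a <;>
    obtain ⟨b, rfl⟩ := Ideal.Quotient.mk_surjective b
    · rw [← map_add, hmk _ _ hij, hmk _ _ hij, hmk _ _ hij, hE.map_add hij, QuotientGroup.mk_mul]
    · rw [hmk _ _ hij, hmk _ _ hkl]
      exact (hE.commute hij hkl hjk hil a b).map (QuotientGroup.mk' N)
    · rw [← map_mul, hmk _ _ hij, hmk _ _ hjk, hmk _ _ hik, ← QuotientGroup.mk_mul,
        hE.mul_comm' hij hjk hik]
      rfl
  refine hx.finite hn ?_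
  rw [eq_top_iff, ← Subgroup.map_top_of_surjective _ (QuotientGroup.mk'_surjective N),
    ← closure_elementaryElem, MonoidHom.map_closure, Subgroup.closure_le]
  rintro _ ⟨_, ⟨i, j, a, hij, rfl⟩, rfl⟩
  exact Subgroup.subset_closure ⟨i, j, _, hij, (hmk i j hij a).symm⟩

end ElementaryGroup

theorem theorem0p5 {G : Type u} [Group G] (hG : IsVirtuallyPolyPositive G)
    {R : Type v} [Ring R] [CharZero R] (hfg : Algebra.FiniteType ℤ R)
    (hR : ∀ I : TwoSidedIdeal R, I ≠ ⊥ → I.asIdeal.toAddSubgroup.FiniteIndex)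
    {n : ℕ} (hn : 3 ≤ n) (S : Subgroup (elementaryGroup n R)) (hS : S.FiniteIndex)
    (f : S →* G) : (f.range : Set G).Finite := by
  obtain ⟨M, hM, hMN⟩ := isSteinberg_elementaryElem.exists_mem_normalCore hn hG S f
  have hbot : natMulIdeal R M ≠ ⊥ := by
    intro h
    have hmem : (M : R) ∈ natMulIdeal R M := mem_natMulIdeal.2 ⟨1, mul_one _⟩
    rw [h, TwoSidedIdeal.mem_bot, Nat.cast_eq_zero] at hmem
    exact hM.ne' hmem
  have hfin : Finite (elementaryGroup n R ⧸ (f.ker.map S.subtype).normalCore) :=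
    finite_quotient_of_mem hn _ (hR _ hbot) _ fun i j hij r hr => by
      obtain ⟨s, rfl⟩ := mem_natMulIdeal.1 hr
      exact hMN i j hij s
  have hcore : (f.ker.map S.subtype).normalCore.FiniteIndex :=
    Subgroup.finiteIndex_of_finite_quotient
  have hker : (f.ker.map S.subtype).FiniteIndex :=
    Subgroup.finiteIndex_of_le (Subgroup.normalCore_le _)
  have hindex := hker.index_ne_zero
  rw [Subgroup.index_map_subtype, Subgroup.index_ker] at hindex
  have : Finite f.range := Nat.finite_of_card_ne_zero (left_ne_zero_of_mul hindex)
  exact Set.toFinite _
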